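/- **Theorem (Kato's inequality for $p$-harmonic maps).** Let $\mathcal M$, $\mathcal N$ be smooth Riemannian manifolds (without boundary) of dimensions $n\ge 2$ and $d\ge 2$, and let $p>1$. For a map $u\colon\mathcal M\to\mathcal N$, let $|\nabla u|$ denote the Hilbert–Schmidt norm of its differential, and let $\nabla^2u=\nabla du$ be its second covariant derivative with respect to the Levi-Civita connections of $\mathcal M$ and $\mathcal N$, that is, in local coordinates $$(\nabla^2u)^a_{ij}=\partial_i\partial_ju^a-\Gamma^k_{ij}\,\partial_ku^a+\Gamma^a_{bc}(u)\,\partial_iu^b\,\partial_ju^c ,$$ again with the Hilbert–Schmidt norm $|\nabla^2u|$. Put $$\kappa(p,n)=\begin{cases}1+\dfrac{(p-1)^2}{n-1}&\text{for }1\le p\le 1+\dfrac{n-1}{\sqrt{2n}-1},\\[2mm] 2-\dfrac{(p-\sqrt{2n})^2}{(\sqrt n-\sqrt 2)^2}&\text{for }1+\dfrac{n-1}{\sqrt{2n}-1}<p\le\sqrt{2n},\\[2mm] 2&\text{for }p>\sqrt{2n}.\end{cases}$$ (For $n=2$ both thresholds equal $2$ and the second case is void.) 1. Let $\Omega\subseteq\mathcal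 M$ be open and let $u\colon \mathcal M\to\mathcal N$ be $p$-harmonic on $\Omega$, i.e. $u$ is of class $C^1$ on $\Omega$ and is a critical point of the energy $E_p(u)=\int|\nabla u|^p\,d\mathrm{vol}$ with respect to smooth variations with compact support in $\Omega$. Let $q\in\Omega$ be a point such that $u$ is of class $C^2$ near $q$ and $\nabla u(q)\neq0$. Then, at $q$, $$\kappa(p,n)\,\bigl|\nabla|\nabla u|\bigr|^2\le|\nabla^2u|^2 .$$ 2. The constant $\kappa(p,n)$ is pointwise sharp: for every $q\in\mathcal M$ and every $b\in\mathcal N$ there is a smooth map $u\colon\mathcal M\to\mathcal N$ with $u(q)=b$ and $\nabla u(q)\ne0$ which solves the $p$-harmonic equation $\operatorname{div}(|\nabla u|^{p-2}\nabla u)=0$ (covariant divergence of the section $|\nabla u|^{p-2}\nabla u$ of $T^*\mathcal M\otimes u^*T\mathcal N$) at the point $q$, and for which, at $q$, $$\kappa(p,n)\,\bigl|\nabla|\nabla u|\bigr|^2=|\nabla^2u|^2\quad\text{and}\quad \nabla|\nabla u|\neq0 .$$ -/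

import Mathlib

open scoped Manifold ContDiff Bundle

noncomputable section

namespace PHarmonic

/-- The model space `ℝⁿ` in which coordinates take their values. -/
abbrev Coord (n : ℕ) : Type := EuclideanSpace ℝ (Fin n)

/-! ### Calculus in local coordinates

Below `g` and `h` are the coefficient matrices `g_{ij}`, `h_{ab}` of the metrics of the domain and of
the target in local coordinates, and `v` is the coordinate expression of a map. -/

/-- The partial derivative `∂_i f (y)`. -/
def pd {n : ℕ} (f : Coord n → ℝ) (i : Fin n) (y : Coord n) : ℝ :=
  fderiv ℝ f y (EuclideanSpace.single i 1)

/-- `∂_i v^a (y)`. -/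
def jac {n d : ℕ} (v : Coord n → Coord d) (a : Fin d) (i : Fin n) (y : Coord n) : ℝ :=
  pd (fun z => v z a) i y

/-- The Christoffel symbol `Γ^k_{ij}(y)` of the Levi-Civita connection of `g`. -/
def christoffel {n : ℕ} (g : Coord n → Matrix (Fin n) (Fin n) ℝ) (y : Coord n)
    (k i j : Fin n) : ℝ :=
  (1 / 2 : ℝ) * ∑ l, (g y)⁻¹ k l *
    (pd (fun z => g z j l) i y + pd (fun z => g z i l) j y - pd (fun z => g z i j) l y)

/-- `|∇v|² = g^{ij} h_{ab}(v) ∂_i v^a ∂_j v^b`. -/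
def gradSq {n d : ℕ} (g : Coord n → Matrix (Fin n) (Fin n) ℝ)
    (h : Coord d → Matrix (Fin d) (Fin d) ℝ) (v : Coord n → Coord d) (y : Coord n) : ℝ :=
  ∑ i, ∑ j, ∑ a, ∑ b, (g y)⁻¹ i j * h (v y) a b * jac v a i y * jac v b j y

/-- `|∇v|`. -/
def gradNorm {n d : ℕ} (g : Coord n → Matrix (Fin n) (Fin n) ℝ)
    (h : Coord d → Matrix (Fin d) (Fin d) ℝ) (v : Coord n → Coord d) (y : Coord n) : ℝ :=
  Real.sqrt (gradSq g h v y)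

/-- The squared length of the gradient of the function `|∇v|`: `g^{ij} ∂_i |∇v| ∂_j |∇v|`. -/
def gradGradNormSq {n d : ℕ} (g : Coord n → Matrix (Fin n) (Fin n) ℝ)
    (h : Coord d → Matrix (Fin d) (Fin d) ℝ) (v : Coord n → Coord d) (y : Coord n) : ℝ :=
  ∑ i, ∑ j, (g y)⁻¹ i j * pd (gradNorm g h v) i y * pd (gradNorm g h v) j y

/-- The coefficients of the second covariant derivative `∇²v = ∇dv`:
`∂_i ∂_j v^a - Γ^k_{ij} ∂_k v^a + Γ^a_{bc}(v) ∂_i v^b ∂_j v^c`, with the Christoffel symbols of `g` and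
of `h` respectively. -/
def hess {n d : ℕ} (g : Coord n → Matrix (Fin n) (Fin n) ℝ)
    (h : Coord d → Matrix (Fin d) (Fin d) ℝ) (v : Coord n → Coord d) (y : Coord n)
    (a : Fin d) (i j : Fin n) : ℝ :=
  pd (fun z => jac v a j z) i y - ∑ k, christoffel g y k i j * jac v a k y
    + ∑ b, ∑ c, christoffel h (v y) a b c * jac v b i y * jac v c j y

/-- `|∇²v|² = g^{ik} g^{jl} h_{ab}(v) (∇²v)^a_{ij} (∇²v)^b_{kl}`. -/
def hessSq {n d : ℕ} (g : Coord n → Matrix (Fin n) (Fin n) ℝ)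
    (h : Coord d → Matrix (Fin d) (Fin d) ℝ) (v : Coord n → Coord d) (y : Coord n) : ℝ :=
  ∑ i, ∑ j, ∑ k, ∑ l, ∑ a, ∑ b, (g y)⁻¹ i k * (g y)⁻¹ j l * h (v y) a b *
    hess g h v y a i j * hess g h v y b k l

/-- The Riemannian volume density `√(det g)`. -/
def volDensity {n : ℕ} (g : Coord n → Matrix (Fin n) (Fin n) ℝ) (y : Coord n) : ℝ :=
  Real.sqrt (g y).det

/-- The components of the covariant divergence `div (|∇v|^{p-2} ∇v)`, which is a vector field along `v`:
`(det g)^{-1/2} ∂_i ((det g)^{1/2} |∇v|^{p-2} g^{ij} ∂_j v^a)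
  + |∇v|^{p-2} g^{ij} Γ^a_{bc}(v) ∂_i v^b ∂_j v^c`. -/
def pTension {n d : ℕ} (p : ℝ) (g : Coord n → Matrix (Fin n) (Fin n) ℝ)
    (h : Coord d → Matrix (Fin d) (Fin d) ℝ) (v : Coord n → Coord d) (y : Coord n)
    (a : Fin d) : ℝ :=
  (volDensity g y)⁻¹ *
      ∑ i, pd (fun z => volDensity g z * gradNorm g h v z ^ (p - 2) *
        ∑ j, (g z)⁻¹ i j * jac v a j z) i y
    + gradNorm g h v y ^ (p - 2) *
      ∑ i, ∑ j, ∑ b, ∑ c, (g y)⁻¹ i j * christoffel h (v y) a b c * jac v b i y * jac v c j y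

/-! ### Maps between Riemannian manifolds -/

section Manifold

variable {n d : ℕ}
  {M : Type*} [TopologicalSpace M] [ChartedSpace (EuclideanSpace ℝ (Fin n)) M]
  [Bundle.RiemannianBundle (fun x : M => TangentSpace (𝓡 n) x)]
  {N : Type*} [TopologicalSpace N] [ChartedSpace (EuclideanSpace ℝ (Fin d)) N]
  [Bundle.RiemannianBundle (fun x : N => TangentSpace (𝓡 d) x)]

/-- The coordinate vector field `∂_i` of the chart around `x₀`, at the point with coordinates `y`. -/
def coordVec (x₀ : M) (y : Coord n) (i : Fin n) :
    TangentSpace (𝓡 n) ((extChartAt (𝓡 n) x₀).symm y) :=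
  mfderiv 𝓘(ℝ, Coord n) (𝓡 n) (extChartAt (𝓡 n) x₀).symm y
    (EuclideanSpace.single i (1 : ℝ) : Coord n)

/-- The coefficients `g_{ij} = ⟨∂_i, ∂_j⟩` of the Riemannian metric in the chart around `x₀`. -/
def metricCoeff (x₀ : M) (y : Coord n) : Matrix (Fin n) (Fin n) ℝ :=
  Matrix.of fun i j => inner ℝ (coordVec x₀ y i) (coordVec x₀ y j)

/-- The expression of `u` in the charts around `x₀` and `y₀`. -/
def chartRep (u : M → N) (x₀ : M) (y₀ : N) (y : Coord n) : Coord d :=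
  extChartAt (𝓡 d) y₀ (u ((extChartAt (𝓡 n) x₀).symm y))

/-- `|∇|∇u||²` at the point `q`. -/
def gradGradNormSqAt (u : M → N) (q : M) : ℝ :=
  gradGradNormSq (metricCoeff (n := n) q) (metricCoeff (n := d) (u q))
    (chartRep (n := n) (d := d) u q (u q)) (extChartAt (𝓡 n) q q)

/-- `|∇²u|²` at the point `q`. -/
def hessSqAt (u : M → N) (q : M) : ℝ :=
  hessSq (metricCoeff (n := n) q) (metricCoeff (n := d) (u q))
    (chartRep (n := n) (d := d) u q (u q)) (extChartAt (𝓡 n) q q)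

/-- `u` solves the `p`-harmonic equation `div (|∇u|^{p-2} ∇u) = 0` at the point `q`. -/
def SolvesPHarmonicAt (p : ℝ) (u : M → N) (q : M) : Prop :=
  ∀ a : Fin d, pTension p (metricCoeff (n := n) q) (metricCoeff (n := d) (u q))
    (chartRep (n := n) (d := d) u q (u q))
    (extChartAt (𝓡 n) q q) a = 0

/-- The `p`-energy `∫_K |∇v|^p dvol` over the set of points whose coordinates lie in `K`, of the map
with expression `v` in the charts around `x₀` and `y₀`. -/
def chartEnergy (p : ℝ) (x₀ : M) (y₀ : N) (K : Set (Coord n)) (v : Coord n → Coord d) : ℝ :=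
  ∫ y in K, gradNorm (metricCoeff x₀) (metricCoeff y₀) v y ^ p * volDensity (metricCoeff x₀) y

/-- `u` is a `p`-harmonic map on the open set `Ω`: it is of class `C¹` there and it is a critical point
of the `p`-energy with respect to smooth variations of compact support. It suffices to consider
variations with support in a coordinate domain which `u` maps into a coordinate domain; they are written
`v + t φ` in coordinates. For small `t` these are coordinate expressions of maps to `N`. -/
def IsPHarmonicOn (p : ℝ) (u : M → N) (Ω : Set M) : Prop :=
  ContMDiffOn (𝓡 n) (𝓡 d) 1 u Ω ∧
  ∀ (x₀ : M) (y₀ : N) (φ : Coord n → Coord d), ContDiff ℝ ∞ φ → HasCompactSupport φ →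
    (∀ y ∈ tsupport φ, y ∈ (extChartAt (𝓡 n) x₀).target ∧
      (extChartAt (𝓡 n) x₀).symm y ∈ Ω ∧
      u ((extChartAt (𝓡 n) x₀).symm y) ∈ (extChartAt (𝓡 d) y₀).source) →
    HasDerivAt (fun t : ℝ => chartEnergy p x₀ y₀ (tsupport φ)
      (fun y => chartRep u x₀ y₀ y + t • φ y)) 0 0

end Manifold

/-- The constant `κ(p, n)`. For `n = 2` both thresholds are equal to `2`, and the second case is void. -/
def kappa (p : ℝ) (n : ℕ) : ℝ :=
  if p ≤ 1 + ((n : ℝ) - 1) / (Real.sqrt (2 * n) - 1) then 1 + (p - 1) ^ 2 / ((n : ℝ) - 1)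
  else if p ≤ Real.sqrt (2 * n) then
    2 - (p - Real.sqrt (2 * n)) ^ 2 / (Real.sqrt n - Real.sqrt 2) ^ 2
  else 2

end PHarmonic

end

noncomputable section

namespace PHarmonic

/-! Where ∇u ≠ 0, the inequality is a statement about the 2-jet of u at one point. In orthonormal
frames write J = ∇u, T = ∇²u, Q = |J|², V_k = ⟨J, T_k⟩ and L_a = ∑ V_i J_ai. Metric compatibility
gives V = |∇u| ∇|∇u|, and the p-harmonic equation becomes Q tr T_a + (p-2) L_a = 0. The claim is
then κ|V|² ≤ Q|T|².

Pair T with the test tensor X_s = sym(J ⊗ V) - s L ⊗ id. For V ≠ 0 put μ = |L|²/(Q|V|²), which lies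
in [0, 1]. Symmetry of T and the equation give ⟨T, X_s⟩ = |V|²(1 + (p-2)sμ), while |X_s|² =
Q|V|²((1+μ)/2 - 2sμ + nμs²). Cauchy-Schwarz with the best s yields |V|² `katoNum` ≤ Q|T|² `katoDen`.
The minimum of `katoNum / katoDen` over μ ∈ [0, 1] is κ: it is attained at μ = 1 in the first range
of p, at a zero of a perfect square in the second, and at μ = 0 in the third. This is
`kato_orthonormal`.

Equality in Cauchy-Schwarz suggests taking T = X_s itself. A diagonal J with entries √μ and √(1-μ)
realizes the minimizing μ, which is where two dimensions on each side are used
(`exists_kato_orthonormal_eq`). Any 2-jet with symmetric covariant Hessian comes from a quadratic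
polynomial in charts, which a cutoff extends to all of M.

The analytic link is `pTension_eq_zero`: near a point where u is C² and ∇u ≠ 0, the energy density
is C¹ jointly in the variation parameter and the position. One may therefore differentiate under the
integral, integrate by parts, and pass from the weak equation to the pointwise one. -/

/-! ### The constant κ as the minimum of a rational function. -/

theorem one_lt_sqrt_two_mul {n : ℕ} (hn : 2 ≤ n) : 1 < Real.sqrt (2 * n) := by
  have hn' : (2 : ℝ) ≤ n := by exact_mod_cast hn
  rw [Real.lt_sqrt (by norm_num)]; linarith

theorem le_kappa_threshold_iff {n : ℕ} (hn : 2 ≤ n) (p : ℝ) :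
    p ≤ 1 + ((n : ℝ) - 1) / (Real.sqrt (2 * n) - 1) ↔
      (Real.sqrt (2 * n) - 1) * (p - 1) ≤ n - 1 := by
  have h2 := one_lt_sqrt_two_mul hn
  rw [← sub_le_iff_le_add', le_div_iff₀ (by linarith), mul_comm]

/-- This is the condition for the minimum over [0, 1] to sit at μ = 1. The difference of the two
sides factors, and one factor is exactly the slack in the threshold for p. -/
theorem kappa_low {n : ℕ} (hn : 2 ≤ n) {p : ℝ} (hp : 1 < p)
    (h : (Real.sqrt (2 * n) - 1) * (p - 1) ≤ n - 1) :
    (p - 2) ^ 2 ≤ n * (2 - (1 + (p - 1) ^ 2 / ((n : ℝ) - 1))) := by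
  have hn' : (2 : ℝ) ≤ n := by exact_mod_cast hn
  have h1 : Real.sqrt (2 * n) ^ 2 = 2 * n := Real.sq_sqrt (by positivity)
  have h2 := one_lt_sqrt_two_mul hn
  have h3 : 0 ≤ ((n : ℝ) - 1 - (Real.sqrt (2 * n) - 1) * (p - 1)) *
      ((Real.sqrt (2 * n) + 1) * (p - 1) + (n - 1)) :=
    mul_nonneg (by linarith)
      (add_nonneg (mul_nonneg (by linarith) (by linarith)) (by linarith))
  have h4 : (n : ℝ) * (2 - (1 + (p - 1) ^ 2 / ((n : ℝ) - 1))) - (p - 2) ^ 2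
      = (((n : ℝ) - 1 - (Real.sqrt (2 * n) - 1) * (p - 1)) *
      ((Real.sqrt (2 * n) + 1) * (p - 1) + (n - 1))) / (n - 1) := by
    have : (n : ℝ) - 1 ≠ 0 := by linarith
    generalize Real.sqrt (2 * n) = τ at h1
    field_simp
    linear_combination (p - 1) ^ 2 * h1
  have h5 := div_nonneg h3 (by linarith : (0 : ℝ) ≤ n - 1)
  linarith

/-- In the middle range `κ = 2 - w²`, with `w = (√(2n) - p) / (√n - √2)`. -/
theorem kappa_mid {n : ℕ} (hn : 2 ≤ n) {p : ℝ}
    (h : ¬ (Real.sqrt (2 * n) - 1) * (p - 1) ≤ n - 1) (h' : p ≤ Real.sqrt (2 * n)) :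
    ∃ w : ℝ, 0 ≤ w ∧ 0 < p - 2 ∧ Real.sqrt n * w ≤ p - 2 ∧
      2 - (p - Real.sqrt (2 * n)) ^ 2 / (Real.sqrt n - Real.sqrt 2) ^ 2 = 2 - w ^ 2 ∧
      (p - 2) ^ 2 + 4 * (p - 2) - (2 - w ^ 2) * (n - 2) =
        -2 * (p - 2) * (Real.sqrt n * w) := by
  have hn' : (2 : ℝ) ≤ n := by exact_mod_cast hn
  have hs : Real.sqrt n ^ 2 = n := Real.sq_sqrt (by positivity)
  have ht : Real.sqrt 2 ^ 2 = 2 := Real.sq_sqrt (by norm_num)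
  have hst : Real.sqrt (2 * n) = Real.sqrt n * Real.sqrt 2 := by
    rw [Real.sqrt_mul (by norm_num), mul_comm]
  have hτ := one_lt_sqrt_two_mul hn
  rw [hst] at h h' hτ ⊢
  have hs0 : 0 < Real.sqrt n := Real.sqrt_pos.2 (by linarith)
  have ht0 : 0 < Real.sqrt 2 := Real.sqrt_pos.2 (by norm_num)
  have hle : Real.sqrt 2 ≤ Real.sqrt n := Real.sqrt_le_sqrt hn'
  generalize Real.sqrt n = s at *
  generalize Real.sqrt 2 = t at *
  push Not at h
  rw [← hs] at h ⊢
  -- For n = 2 the middle range is empty, so the denominator √n - √2 does not vanish.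
  have hlt : t < s := by
    refine lt_of_le_of_ne hle fun e => ?_
    subst e
    nlinarith
  have hd : s - t ≠ 0 := by linarith
  -- The failed threshold condition, with st - 1 subtracted from both sides.
  have hr : s * (s - t) < (s * t - 1) * (p - 2) := by nlinarith
  have hr0 : 0 < p - 2 := by
    have : 0 < (s * t - 1) * (p - 2) := lt_trans (mul_pos hs0 (by linarith)) hr
    exact pos_of_mul_pos_right this (by linarith)
  have hw : (s * t - p) / (s - t) * (s - t) = s * t - p := div_mul_cancel₀ _ hd
  have h2 : s ^ 2 - 2 = (s - t) * (s + t) := by linear_combination ht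
  refine ⟨(s * t - p) / (s - t), div_nonneg (by linarith) (by linarith), hr0, ?_, ?_, ?_⟩
  · rw [← mul_div_assoc, div_le_iff₀ (by linarith)]
    -- After clearing denominators, √n w ≤ p - 2 is `hr` multiplied by t and simplified with t² = 2.
    have h3 : t * (s * (s - t)) < t * ((s * t - 1) * (p - 2)) := mul_lt_mul_of_pos_left hr ht0
    have h4 : t * ((s * t - 1) * (p - 2)) = (2 * s - t) * (p - 2) := by
      linear_combination s * (p - 2) * ht
    nlinarith
  · rw [← div_pow, div_pow, div_pow]; ring
  · generalize (s * t - p) / (s - t) = w at *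
    have hp : p = s * t - w * (s - t) := by linarith
    rw [h2, hp]
    linear_combination (s ^ 2 + 2 * s * w + 2) * ht

/-- The minimum over `μ ∈ [0, 1]` of `katoNum / katoDen` is `κ(p, n)`. -/
def katoNum (p n μ : ℝ) : ℝ :=
  2 * n + 4 * (p - 2) * μ + (p - 2) ^ 2 * μ * (1 + μ)

def katoDen (n μ : ℝ) : ℝ := n * (1 + μ) - 2 * μ

/-- In each range `katoNum - κ katoDen`, a quadratic in μ, has a visible sign: it is a product
vanishing at μ = 1, a perfect square, or a product vanishing at μ = 0. -/
theorem kappa_mul_katoDen_le {n : ℕ} (hn : 2 ≤ n) {p μ : ℝ} (hp : 1 < p) (h0 : 0 ≤ μ)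
    (h1 : μ ≤ 1) : kappa p n * katoDen n μ ≤ katoNum p n μ := by
  have hn' : (2 : ℝ) ≤ n := by exact_mod_cast hn
  unfold kappa katoNum katoDen
  simp only [le_kappa_threshold_iff hn]
  split_ifs with h h'
  · have hk := kappa_low hn hp h
    have hn1 : (n : ℝ) - 1 ≠ 0 := by linarith
    have hκ : ((n : ℝ) - 1) * (1 + (p - 1) ^ 2 / ((n : ℝ) - 1)) = n - 1 + (p - 1) ^ 2 := by
      field_simp
    generalize 1 + (p - 1) ^ 2 / ((n : ℝ) - 1) = κ at *
    -- The difference is (1 - μ)(n(2 - κ) - (p-2)²μ); `kappa_low` controls the second factor at μ =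
    -- 1, hence for every μ ≤ 1.
    have h3 : 0 ≤ (1 - μ) * (n * (2 - κ) - (p - 2) ^ 2 * μ) :=
      mul_nonneg (by linarith) (by nlinarith [sq_nonneg (p - 2)])
    linear_combination h3 + 2 * μ * hκ
  · obtain ⟨w, -, -, -, hκ, hid⟩ := kappa_mid hn h h'
    have hs : Real.sqrt n ^ 2 = n := Real.sq_sqrt (by positivity)
    rw [hκ]
    -- The identity `hid` says that the discriminant in μ vanishes, so the difference is this
    -- square.
    linear_combination sq_nonneg ((p - 2) * μ - Real.sqrt n * w) + w ^ 2 * hs - μ * hid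
  · push Not at h'
    have h2 : Real.sqrt (2 * n) ^ 2 = 2 * n := Real.sq_sqrt (by positivity)
    have h3 := one_lt_sqrt_two_mul hn
    have h4 : 2 * (n : ℝ) ≤ p ^ 2 := by rw [← h2]; gcongr
    -- With κ = 2 the difference is μ((p-2)²μ + p² - 2n).
    have h5 : 0 ≤ μ * ((p - 2) ^ 2 * μ + (p ^ 2 - 2 * n)) := mul_nonneg h0 (add_nonneg (by positivity) (by linarith))
    linear_combination h5

theorem exists_kappa_mul_katoDen_eq {n : ℕ} (hn : 2 ≤ n) {p : ℝ} :
    ∃ μ : ℝ, 0 ≤ μ ∧ μ ≤ 1 ∧ kappa p n * katoDen n μ = katoNum p n μ := by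
  have hn' : (2 : ℝ) ≤ n := by exact_mod_cast hn
  unfold kappa katoNum katoDen
  simp only [le_kappa_threshold_iff hn]
  split_ifs with h h'
  · refine ⟨1, zero_le_one, le_rfl, ?_⟩
    have hn1 : (n : ℝ) - 1 ≠ 0 := by linarith
    field_simp
    ring
  · obtain ⟨w, hw, hr, hle, hκ, hid⟩ := kappa_mid hn h h'
    have hs : Real.sqrt n ^ 2 = n := Real.sq_sqrt (by positivity)
    -- The zero of the perfect square; `hle` places it in [0, 1].
    refine ⟨Real.sqrt n * w / (p - 2), by positivity, (div_le_one hr).2 hle, ?_⟩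
    have hμ : (p - 2) * (Real.sqrt n * w / (p - 2)) = Real.sqrt n * w := by
      field_simp
    generalize Real.sqrt n * w / (p - 2) = μ at *
    rw [hκ]
    linear_combination (-(p - 2) * μ + Real.sqrt n * w) * hμ + w ^ 2 * hs - μ * hid
  · exact ⟨0, le_rfl, zero_le_one, by ring⟩

theorem katoDen_pos {n : ℕ} (hn : 2 ≤ n) {μ : ℝ} (h0 : 0 ≤ μ) : 0 < katoDen n μ := by
  have hn' : (2 : ℝ) ≤ n := by exact_mod_cast hn
  unfold katoDen
  nlinarith

theorem katoNum_pos {n : ℕ} (hn : 2 ≤ n) {p μ : ℝ} (hp : 1 < p) (h0 : 0 ≤ μ) (h1 : μ ≤ 1) :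
    0 < katoNum p n μ := by
  have hn' : (2 : ℝ) ≤ n := by exact_mod_cast hn
  unfold katoNum
  have h2 : 0 ≤ (p - 2) ^ 2 * μ * (1 + μ) := by positivity
  rcases h0.eq_or_lt with h | h
  · subst h; nlinarith
  · nlinarith

/-! ### The algebraic inequality and its equality case in orthonormal frames. -/

/-- The squared norm of the test tensor X_s. The symmetrized product contributes half of |J|²|V|²
and half of |L|²; its trace is L, which produces the term linear in s, and |id|² = n gives the
quadratic one. -/
theorem sum_testTensor_sq {n d : ℕ} (J : Fin d → Fin n → ℝ) (V : Fin n → ℝ) (s : ℝ) :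
    ∑ a, ∑ i, ∑ j, ((J a i * V j + J a j * V i) / 2 -
      s * (∑ k, V k * J a k) * if i = j then (1 : ℝ) else 0) ^ 2 =
    (1 / 2) * (∑ a, ∑ i, J a i ^ 2) * (∑ k, V k ^ 2) +
      (1 / 2 - 2 * s + n * s ^ 2) * ∑ a, (∑ k, V k * J a k) ^ 2 := by
  set L : Fin d → ℝ := fun a => ∑ i, V i * J a i with hL
  have e1 : ∑ a, ∑ i, ∑ j, J a i ^ 2 * V j ^ 2 =
      (∑ a, ∑ i, J a i ^ 2) * (∑ k, V k ^ 2) := by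
    simp only [← Finset.sum_mul, ← Finset.mul_sum]
  have e2 : ∑ a, ∑ i, ∑ j, J a j ^ 2 * V i ^ 2 =
      (∑ a, ∑ i, J a i ^ 2) * (∑ k, V k ^ 2) := by
    rw [← e1]
    exact Finset.sum_congr rfl fun a _ => Finset.sum_comm
  have e3 : ∑ a, ∑ i, ∑ j, (V i * J a i) * (V j * J a j) = ∑ a, L a ^ 2 := by
    simp only [hL, sq, Finset.sum_mul_sum]
  have e4 : ∀ a i j, ((J a i * V j + J a j * V i) / 2 -
      s * L a * if i = j then 1 else 0) ^ 2 = (1 / 4) * (J a i ^ 2 * V j ^ 2) +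
        (1 / 4) * (J a j ^ 2 * V i ^ 2) + (1 / 2) * ((V i * J a i) * (V j * J a j)) -
        (if i = j then 2 * s * (L a * (V i * J a i)) else 0) +
        (if i = j then s ^ 2 * L a ^ 2 else 0) := by
    intro a i j
    split_ifs with h
    · subst h; ring
    · ring
  have e5 : ∑ a, ∑ i, 2 * s * (L a * (V i * J a i)) = 2 * s * ∑ a, L a ^ 2 := by
    simp only [← Finset.mul_sum, sq, hL]
  have e6 : ∑ a, ∑ _i : Fin n, s ^ 2 * L a ^ 2 = n * s ^ 2 * ∑ a, L a ^ 2 := by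
    simp [Finset.mul_sum, mul_assoc]
  calc _ = ∑ a, ∑ i, ∑ j, ((J a i * V j + J a j * V i) / 2 -
      s * L a * if i = j then (1 : ℝ) else 0) ^ 2 := rfl
    _ = (1 / 4) * (∑ a, ∑ i, ∑ j, J a i ^ 2 * V j ^ 2) +
        (1 / 4) * (∑ a, ∑ i, ∑ j, J a j ^ 2 * V i ^ 2) +
        (1 / 2) * (∑ a, ∑ i, ∑ j, (V i * J a i) * (V j * J a j)) -
        ∑ a, ∑ i, 2 * s * (L a * (V i * J a i)) + ∑ a, ∑ _i : Fin n, s ^ 2 * L a ^ 2 := by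
      simp only [e4, Finset.sum_sub_distrib, Finset.sum_add_distrib, Finset.mul_sum,
        Finset.sum_ite_eq, Finset.mem_univ, if_true]
    _ = _ := by rw [e1, e2, e3, e5, e6]; ring

/-- The Kato inequality for the second derivative `T` of a `p`-harmonic map with first derivative `J`,
in orthonormal frames. -/
theorem kato_orthonormal {n d : ℕ} (hn : 2 ≤ n) {p : ℝ} (hp : 1 < p) {J : Fin d → Fin n → ℝ}
    {T : Fin d → Fin n → Fin n → ℝ} (hT : ∀ a i j, T a i j = T a j i) {V : Fin n → ℝ}
    (hV : ∀ k, V k = ∑ a, ∑ i, J a i * T a k i) {Q : ℝ} (hQ : Q = ∑ a, ∑ i, J a i ^ 2)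
    (hQ0 : 0 < Q) (heq : ∀ a, Q * ∑ i, T a i i + (p - 2) * ∑ i, V i * J a i = 0) :
    kappa p n * ∑ k, V k ^ 2 ≤ Q * ∑ a, ∑ i, ∑ j, T a i j ^ 2 := by
  have hn' : (2 : ℝ) ≤ n := by exact_mod_cast hn
  set W := ∑ k, V k ^ 2 with hW
  set E := ∑ a, ∑ i, ∑ j, T a i j ^ 2 with hE
  have hE0 : 0 ≤ E := by positivity
  have hW0 : 0 ≤ W := by positivity
  -- If V = 0 the left side vanishes; otherwise μ below is well defined.
  rcases hW0.eq_or_lt with h | hWpos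
  · rw [← h, mul_zero]; positivity
  set L : Fin d → ℝ := fun a => ∑ i, V i * J a i with hL
  set S := ∑ a, L a ^ 2 with hS
  have hS0 : 0 ≤ S := by positivity
  have hSQ : S ≤ Q * W := by
    rw [hQ, Finset.sum_mul]
    refine Finset.sum_le_sum fun a _ => ?_
    rw [mul_comm]
    exact Finset.sum_mul_sq_le_sq_mul_sq _ _ _
  obtain ⟨μ, hμ⟩ : ∃ μ, S = μ * (Q * W) := ⟨S / (Q * W), by field_simp⟩
  have hQW : 0 < Q * W := by positivity
  have hμ0 : 0 ≤ μ := nonneg_of_mul_nonneg_left (hμ ▸ hS0) hQW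
  have hμ1 : μ ≤ 1 := by
    by_contra hc; push Not at hc; nlinarith
  -- Both halves of the symmetrization pair with T to |V|², because T is symmetric and V = ⟨J, T⟩.
  -- The identity part only sees the traces of T, which the equation expresses through L.
  have hpair : ∀ s : ℝ, ∑ a, ∑ i, ∑ j, T a i j * ((J a i * V j + J a j * V i) / 2 -
      s * L a * if i = j then 1 else 0) = W * (1 + (p - 2) * s * μ) := by
    intro s
    have e1 : ∑ a, ∑ i, ∑ j, T a i j * (J a i * V j) = W := by
      have h1 : ∀ j, ∑ a, ∑ i, T a i j * (J a i * V j) = V j ^ 2 := fun j => by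
        rw [sq]
        nth_rewrite 2 [hV j]
        simp only [Finset.sum_mul]
        refine Finset.sum_congr rfl fun a _ => Finset.sum_congr rfl fun i _ => ?_
        rw [hT a i j]; ring
      rw [hW, ← Finset.sum_congr rfl fun j _ => h1 j]
      exact (Finset.sum_congr rfl fun a _ => Finset.sum_comm).trans Finset.sum_comm
    have e2 : ∑ a, ∑ i, ∑ j, T a i j * (J a j * V i) = W := by
      rw [← e1]
      refine Finset.sum_congr rfl fun a _ => ?_
      rw [Finset.sum_comm]
      simp only [hT a]
    have e3 : ∑ a, L a * ∑ i, T a i i = -(p - 2) * μ * W := by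
      have h1 : ∀ a, Q * (L a * ∑ i, T a i i) = -(p - 2) * L a ^ 2 := fun a => by
        linear_combination L a * heq a
      have h2 : Q * ∑ a, L a * ∑ i, T a i i = -(p - 2) * S := by
        rw [Finset.mul_sum, Finset.sum_congr rfl fun a _ => h1 a, ← Finset.mul_sum]
      apply mul_left_cancel₀ hQ0.ne'
      rw [h2, hμ]; ring
    have e4 : ∀ a i j, T a i j * ((J a i * V j + J a j * V i) / 2 -
        s * L a * if i = j then 1 else 0) = T a i j * (J a i * V j) * (1 / 2) +
          T a i j * (J a j * V i) * (1 / 2) - if i = j then s * (L a * T a i j) else 0 := by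
      intro a i j
      split_ifs <;> ring
    simp only [e4, Finset.sum_sub_distrib, Finset.sum_add_distrib, ← Finset.sum_mul, e1, e2,
      Finset.sum_ite_eq, Finset.mem_univ, if_true, ← Finset.mul_sum, e3]
    ring
  have hsq : ∀ s : ℝ, ∑ a, ∑ i, ∑ j, ((J a i * V j + J a j * V i) / 2 -
      s * L a * if i = j then (1 : ℝ) else 0) ^ 2 =
      (Q * W) * ((1 + μ) / 2 - 2 * s * μ + n * s ^ 2 * μ) := by
    intro s
    refine (sum_testTensor_sq J V s).trans ?_
    rw [← hQ, ← hS, ← hW, hμ]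
    ring
  have hCS : ∀ s : ℝ, (W * (1 + (p - 2) * s * μ)) ^ 2 ≤
      E * ((Q * W) * ((1 + μ) / 2 - 2 * s * μ + n * s ^ 2 * μ)) := by
    intro s
    rw [← hpair, ← hsq, hE]
    simp only [← Finset.sum_product']
    exact Finset.sum_mul_sq_le_sq_mul_sq _ _ _
  have hD := katoDen_pos hn hμ0
  have hN := katoNum_pos hn hp hμ0 hμ1
  -- Positive because n ≥ 2, p - 2 > -1 and μ ≤ 1.
  have hm : 0 < n + (p - 2) * μ := by nlinarith
  have hfin : W * katoNum p n μ ≤ E * Q * katoDen n μ := by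
    -- This s is the critical point of ⟨T, X_s⟩²/|X_s|². With it, both sides of Cauchy-Schwarz
    -- factor through `katoNum` and the common denominator cancels.
    have h := hCS ((1 + (p - 2) * (1 + μ) / 2) / (n + (p - 2) * μ))
    have e1 : 1 + (p - 2) * ((1 + (p - 2) * (1 + μ) / 2) / (n + (p - 2) * μ)) * μ =
        katoNum p n μ / (2 * (n + (p - 2) * μ)) := by
      unfold katoNum; field_simp; ring
    have e2 : (1 + μ) / 2 - 2 * ((1 + (p - 2) * (1 + μ) / 2) / (n + (p - 2) * μ)) * μ +
        n * ((1 + (p - 2) * (1 + μ) / 2) / (n + (p - 2) * μ)) ^ 2 * μ =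
        katoNum p n μ * katoDen n μ / (2 * (n + (p - 2) * μ)) ^ 2 := by
      obtain ⟨m, hm'⟩ : ∃ m, m = n + (p - 2) * μ := ⟨_, rfl⟩
      rw [← hm'] at hm ⊢
      unfold katoNum katoDen
      field_simp
      rw [hm']
      ring
    rw [e1, e2] at h
    have h3 := mul_le_mul_of_nonneg_right h (sq_nonneg (2 * (n + (p - 2) * μ)))
    field_simp at h3
    exact h3
  have h4 : kappa p n * katoDen n μ * W ≤ katoNum p n μ * W :=
    mul_le_mul_of_nonneg_right (kappa_mul_katoDen_le hn hp hμ0 hμ1) hW0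
  exact le_of_mul_le_mul_right (by linarith) hD

/-- The equality case of `kato_orthonormal`. -/
theorem exists_kato_orthonormal_eq {n d : ℕ} (hn : 2 ≤ n) (hd : 2 ≤ d) {p : ℝ} (hp : 1 < p) :
    ∃ (J : Fin d → Fin n → ℝ) (T : Fin d → Fin n → Fin n → ℝ) (V : Fin n → ℝ),
      (∀ a i j, T a i j = T a j i) ∧ (∀ k, V k = ∑ a, ∑ i, J a i * T a k i) ∧
      ∑ a, ∑ i, J a i ^ 2 = 1 ∧ (∀ a, ∑ i, T a i i + (p - 2) * ∑ i, V i * J a i = 0) ∧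
      0 < ∑ k, V k ^ 2 ∧ kappa p n * ∑ k, V k ^ 2 = ∑ a, ∑ i, ∑ j, T a i j ^ 2 := by
  have hn' : (2 : ℝ) ≤ n := by exact_mod_cast hn
  obtain ⟨μ, h0, h1, hμ⟩ := exists_kappa_mul_katoDen_eq hn (p := p)
  have hD := katoDen_pos hn h0
  obtain ⟨n, rfl⟩ : ∃ m, n = m + 2 := ⟨n - 2, by omega⟩
  obtain ⟨d, rfl⟩ : ∃ m, d = m + 2 := ⟨d - 2, by omega⟩
  have hm : 0 < ((n + 2 : ℕ) : ℝ) + (p - 2) * μ := by nlinarith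
  generalize hN : ((n + 2 : ℕ) : ℝ) = N at *
  obtain ⟨x, hx⟩ : ∃ x : ℝ, x ^ 2 = μ := ⟨_, Real.sq_sqrt h0⟩
  obtain ⟨y, hy⟩ : ∃ y : ℝ, y ^ 2 = 1 - μ := ⟨_, Real.sq_sqrt (sub_nonneg.2 h1)⟩
  -- The optimal s of `kato_orthonormal`; it is also the value for which X_s satisfies the equation.
  set s := (1 + (p - 2) * (1 + μ) / 2) / (N + (p - 2) * μ) with hs
  have hs' : s * (N + (p - 2) * μ) = 1 + (p - 2) * (1 + μ) / 2 := by
    rw [hs]; field_simp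
  -- T is built from the unit vector e, and the resulting V turns out to be c e, with c as in `hc'`.
  set c := katoDen N μ / (2 * (N + (p - 2) * μ)) with hc
  have hc0 : 0 < c := by positivity
  have hc' : c = (1 + μ) / 2 - s * μ := by
    rw [hc, div_eq_iff (by positivity)]
    unfold katoDen
    linear_combination (2 * μ) * hs'
  -- Here |J|² = 1 and L = x in the first target direction for V = e, so |L|² = μ, as the minimizer
  -- requires.
  let J : Fin (d + 2) → Fin (n + 2) → ℝ := fun a i =>
    (if a = 0 then if i = 0 then x else 0 else 0) + (if a = 1 then if i = 1 then y else 0 else 0)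
  let e : Fin (n + 2) → ℝ := fun i => if i = 0 then 1 else 0
  have hL : ∀ a, ∑ k, e k * J a k = if a = 0 then x else 0 := fun a => by
    simp [e, J]
  have hQ : ∑ a, ∑ i, J a i ^ 2 = 1 := by
    have : ∀ a i, J a i ^ 2 = (if a = 0 then if i = 0 then μ else 0 else 0) +
        (if a = 1 then if i = 1 then 1 - μ else 0 else 0) := fun a i => by
      simp only [J, ← hx]
      split_ifs <;> simp_all
    simp [this, Finset.sum_add_distrib]
  have he : ∑ k, e k ^ 2 = 1 := by simp [e]
  have hJL : ∀ k, ∑ a, J a k * (if a = 0 then x else 0) = μ * e k := fun k => by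
    simp only [mul_ite, mul_zero, Finset.sum_ite_eq', Finset.mem_univ, if_true, J, e, ← hx]
    split_ifs <;> simp_all [sq]
  let T : Fin (d + 2) → Fin (n + 2) → Fin (n + 2) → ℝ := fun a i j =>
    (J a i * e j + J a j * e i) / 2 - s * (∑ k, e k * J a k) * if i = j then (1 : ℝ) else 0
  have hV : ∀ k, c * e k = ∑ a, ∑ i, J a i * T a k i := fun k => by
    have h1 : ∀ a i, J a i * T a k i = (1 / 2) * (J a k * (e i * J a i)) +
        (1 / 2) * (J a i ^ 2 * e k) -
        (if k = i then s * (J a i * if a = 0 then x else 0) else 0) := fun a i => by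
      simp only [T, hL]
      split_ifs <;> ring
    simp only [h1, Finset.sum_add_distrib, Finset.sum_sub_distrib, ← Finset.mul_sum, hL, hJL,
      ← Finset.sum_mul, hQ, Finset.sum_ite_eq, Finset.mem_univ, if_true]
    rw [hc']; ring
  have htr : ∀ a, ∑ i, T a i i = (1 - s * N) * if a = 0 then x else 0 := fun a => by
    have h1 : ∀ i, T a i i = e i * J a i - s * if a = 0 then x else 0 := fun i => by
      simp only [T, hL]
      simp
      ring
    simp only [h1, Finset.sum_sub_distrib, hL, Finset.sum_const, Finset.card_univ,
      Fintype.card_fin, nsmul_eq_mul, hN]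
    ring
  refine ⟨J, T, fun k => c * e k, fun a i j => ?_, hV, hQ, fun a => ?_, ?_, ?_⟩
  · simp only [T, eq_comm (a := i) (b := j)]; ring
  -- The equation reduces to 1 - sN + (p-2)c = 0, which is the defining relation of s.
  · simp only [htr, mul_assoc, ← Finset.mul_sum, hL, hc']
    linear_combination (-(if a = 0 then x else 0)) * hs'
  · simp only [mul_pow, ← Finset.mul_sum, he]; positivity
  · have h1 := sum_testTensor_sq J e s
    simp only [hQ, he, hL, hN] at h1
    simp only [T, mul_pow, ← Finset.mul_sum, he, hL]
    rw [h1]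
    have h2 : ∑ a : Fin (d + 2), (if a = 0 then x else 0) ^ 2 = μ := by simp [hx]
    have h3 : katoNum p N μ = 2 * (N + (p - 2) * μ) * (1 + (p - 2) * s * μ) := by
      unfold katoNum
      linear_combination (-2 * (p - 2) * μ) * hs'
    have h4 : katoDen N μ = 2 * (N + (p - 2) * μ) * c := by rw [hc]; field_simp
    have h5 : kappa p (n + 2) * c = 1 + (p - 2) * s * μ := by
      rw [h3, h4] at hμ
      apply mul_left_cancel₀ (mul_pos two_pos hm).ne'
      linear_combination hμ
    rw [h2]
    have h6 : kappa p (n + 2) * c ^ 2 = (1 + (p - 2) * s * μ) * c := by rw [← h5]; ring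
    rw [mul_one, h6, hc']
    linear_combination (- s * μ) * hs'

/-! ### Passage from coordinates to orthonormal frames. -/

section Frames

theorem sum_gram_contract' {m : ℕ} {G A : Matrix (Fin m) (Fin m) ℝ} (hG : G = A.transpose * A)
    (x : Fin m → Fin m → ℝ) :
    ∑ i, ∑ j, G i j * x i j = ∑ k, ∑ i, A k i * ∑ j, A k j * x i j := by
  simp only [hG, Matrix.mul_apply, Matrix.transpose_apply, Finset.sum_mul, Finset.mul_sum]
  refine (Finset.sum_congr rfl fun i _ => Finset.sum_comm).trans ?_
  rw [Finset.sum_comm]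
  simp only [mul_assoc]

theorem sum_gram_contract {m : ℕ} {G A : Matrix (Fin m) (Fin m) ℝ} (hG : G = A.transpose * A)
    (x y : Fin m → ℝ) :
    ∑ i, ∑ j, G i j * (x i * y j) = ∑ k, (∑ i, A k i * x i) * ∑ j, A k j * y j := by
  rw [sum_gram_contract' hG]
  refine Finset.sum_congr rfl fun k _ => ?_
  rw [Finset.sum_mul_sum]
  simp only [Finset.mul_sum]
  refine Finset.sum_congr rfl fun i _ => Finset.sum_congr rfl fun j _ => ?_
  ring

/-- For the inverse metric of the domain the rows of A form an orthonormal frame; for the metric of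
the target they form an orthonormal coframe. The inverse A' is needed to carry the extremal tensors
back to coordinates. -/
theorem exists_gram {m : ℕ} {G : Matrix (Fin m) (Fin m) ℝ} (hG : G.PosDef) :
    ∃ A A' : Matrix (Fin m) (Fin m) ℝ, G = A.transpose * A ∧ A' * A = 1 ∧ A * A' = 1 := by
  open scoped MatrixOrder in
  obtain ⟨A, hA⟩ := CStarAlgebra.nonneg_iff_eq_star_mul_self.mp hG.posSemidef.nonneg
  have hA' : G = A.transpose * A := by
    rw [hA, Matrix.star_eq_conjTranspose, Matrix.conjTranspose_eq_transpose_of_trivial]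
  have hdet : G.det ≠ 0 := hG.det_pos.ne'
  have hu : IsUnit A.det := by
    rw [hA', Matrix.det_mul] at hdet
    exact (right_ne_zero_of_mul hdet).isUnit
  exact ⟨A, A⁻¹, hA', Matrix.nonsing_inv_mul _ hu, Matrix.mul_nonsing_inv _ hu⟩

variable {n d : ℕ} {G A A' : Matrix (Fin n) (Fin n) ℝ} {H B B' : Matrix (Fin d) (Fin d) ℝ}

/-- The components of `J` in the frames given by `A` and `B`. -/
def frameJ (A : Matrix (Fin n) (Fin n) ℝ) (B : Matrix (Fin d) (Fin d) ℝ) (J : Fin d → Fin n → ℝ)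
    (c : Fin d) (m : Fin n) : ℝ :=
  ∑ i, A m i * ∑ a, B c a * J a i

/-- The components of `T` in the frames given by `A` and `B`. -/
def frameT (A : Matrix (Fin n) (Fin n) ℝ) (B : Matrix (Fin d) (Fin d) ℝ)
    (T : Fin d → Fin n → Fin n → ℝ) (c : Fin d) (m r : Fin n) : ℝ :=
  ∑ i, A m i * ∑ j, A r j * ∑ a, B c a * T a i j

theorem of_frameJ (A : Matrix (Fin n) (Fin n) ℝ) (B : Matrix (Fin d) (Fin d) ℝ)
    (J : Fin d → Fin n → ℝ) :
    Matrix.of (frameJ A B J) = B * Matrix.of J * A.transpose := by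
  ext c m
  simp [frameJ, Matrix.mul_apply, mul_comm]

theorem of_frameT (A : Matrix (Fin n) (Fin n) ℝ) (B : Matrix (Fin d) (Fin d) ℝ)
    (T : Fin d → Fin n → Fin n → ℝ) (c : Fin d) :
    Matrix.of (frameT A B T c) = A * (∑ a, B c a • Matrix.of (T a)) * A.transpose := by
  ext m r
  simp only [frameT, Matrix.mul_apply, Matrix.transpose_apply, Matrix.sum_apply,
    Matrix.smul_apply, Matrix.of_apply, smul_eq_mul, Finset.sum_mul, mul_assoc]
  rw [Finset.sum_comm]
  refine Finset.sum_congr rfl fun i _ => ?_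
  rw [Finset.mul_sum]
  refine Finset.sum_congr rfl fun j _ => ?_
  simp only [Finset.mul_sum]
  refine Finset.sum_congr rfl fun a _ => ?_
  ring

theorem frameJ_inv (hA : A * A' = 1) (hB : B * B' = 1) (J : Fin d → Fin n → ℝ) :
    frameJ A B (frameJ A' B' J) = J := by
  apply Matrix.of.injective
  rw [of_frameJ, of_frameJ, ← Matrix.mul_assoc, ← Matrix.mul_assoc, hB, Matrix.one_mul,
    Matrix.mul_assoc, ← Matrix.transpose_mul, hA, Matrix.transpose_one, Matrix.mul_one]

theorem frameT_inv (hA : A * A' = 1) (hB : B * B' = 1) (T : Fin d → Fin n → Fin n → ℝ) :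
    frameT A B (frameT A' B' T) = T := by
  have hB1 : ∀ c a, ∑ b, B c b * B' b a = if c = a then 1 else 0 := fun c a => by
    rw [← Matrix.mul_apply, hB, Matrix.one_apply]
  funext c
  apply Matrix.of.injective
  have h1 : ∑ a, B c a • ∑ b, B' a b • Matrix.of (T b) = Matrix.of (T c) := by
    simp only [Finset.smul_sum, smul_smul]
    rw [Finset.sum_comm]
    simp only [← Finset.sum_smul, hB1]
    simp
  have h2 : ∑ a, B c a • (A' * (∑ b, B' a b • Matrix.of (T b)) * A'.transpose) =
      A' * (∑ a, B c a • ∑ b, B' a b • Matrix.of (T b)) * A'.transpose := by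
    simp only [Matrix.mul_sum, Matrix.sum_mul, Matrix.mul_smul, Matrix.smul_mul, Finset.smul_sum]
  rw [of_frameT]
  simp only [of_frameT]
  rw [h2, h1, ← Matrix.mul_assoc, ← Matrix.mul_assoc, hA, Matrix.one_mul, Matrix.mul_assoc,
    ← Matrix.transpose_mul, hA, Matrix.transpose_one, Matrix.mul_one]

theorem frameT_symm {T : Fin d → Fin n → Fin n → ℝ} (hT : ∀ a i j, T a i j = T a j i)
    (c : Fin d) (m r : Fin n) : frameT A B T c m r = frameT A B T c r m := by
  simp only [frameT, Finset.mul_sum]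
  rw [Finset.sum_comm]
  refine Finset.sum_congr rfl fun i _ => Finset.sum_congr rfl fun j _ =>
    Finset.sum_congr rfl fun a _ => ?_
  rw [hT a i j]
  ring

theorem sum_frameJ_sq (hG : G = A.transpose * A) (hH : H = B.transpose * B)
    (J : Fin d → Fin n → ℝ) :
    ∑ i, ∑ j, ∑ a, ∑ b, G i j * H a b * J a i * J b j = ∑ c, ∑ m, frameJ A B J c m ^ 2 := by
  have h1 : ∀ i j, ∑ a, ∑ b, G i j * H a b * J a i * J b j =
      ∑ c, G i j * ((∑ a, B c a * J a i) * ∑ b, B c b * J b j) := fun i j => by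
    rw [← Finset.mul_sum, ← sum_gram_contract hH]
    simp only [Finset.mul_sum, mul_assoc]
  simp only [h1]
  rw [(Finset.sum_congr rfl fun i _ => Finset.sum_comm).trans Finset.sum_comm]
  simp only [sum_gram_contract hG, frameJ, sq]

theorem sum_frameT_sq (hG : G = A.transpose * A) (hH : H = B.transpose * B)
    (T : Fin d → Fin n → Fin n → ℝ) :
    ∑ i, ∑ j, ∑ k, ∑ l, ∑ a, ∑ b, G i k * G j l * H a b * T a i j * T b k l =
      ∑ c, ∑ m, ∑ r, frameT A B T c m r ^ 2 := by
  have h1 : ∀ i j k l, ∑ a, ∑ b, G i k * G j l * H a b * T a i j * T b k l =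
      ∑ c, G i k * (G j l * ((∑ a, B c a * T a i j) * ∑ b, B c b * T b k l)) := fun i j k l => by
    rw [← Finset.mul_sum, ← Finset.mul_sum, ← sum_gram_contract hH]
    simp only [Finset.mul_sum, mul_assoc]
  have h2 : ∀ i k, ∑ j, ∑ l, ∑ c, G i k * (G j l * ((∑ a, B c a * T a i j) *
      ∑ b, B c b * T b k l)) = ∑ c, ∑ r, G i k * ((∑ j, A r j * ∑ a, B c a * T a i j) *
        ∑ l, A r l * ∑ b, B c b * T b k l) := fun i k => by
    rw [(Finset.sum_congr rfl fun i _ => Finset.sum_comm).trans Finset.sum_comm]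
    simp only [← Finset.mul_sum, sum_gram_contract hG]
  have h3 : ∀ i, ∑ j, ∑ k, ∑ l, ∑ a, ∑ b, G i k * G j l * H a b * T a i j * T b k l =
      ∑ k, ∑ c, ∑ r, G i k * ((∑ j, A r j * ∑ a, B c a * T a i j) *
        ∑ l, A r l * ∑ b, B c b * T b k l) := fun i => by
    simp only [h1]
    rw [Finset.sum_comm]
    simp only [h2]
  simp only [h3]
  rw [(Finset.sum_congr rfl fun i _ => Finset.sum_comm).trans Finset.sum_comm]
  refine Finset.sum_congr rfl fun c _ => ?_
  rw [(Finset.sum_congr rfl fun i _ => Finset.sum_comm).trans Finset.sum_comm]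
  simp only [sum_gram_contract hG]
  rw [Finset.sum_comm]
  simp only [frameT, sq]

/-- The definition of V as a contraction of J with T is invariant under change of frame; only the
free index k gets transformed. -/
theorem frame_sum_mul (hG : G = A.transpose * A) (hH : H = B.transpose * B)
    (J : Fin d → Fin n → ℝ) (T : Fin d → Fin n → Fin n → ℝ) (m : Fin n) :
    ∑ k, A m k * ∑ i, ∑ j, ∑ a, ∑ b, G i j * H a b * J a i * T b k j =
      ∑ c, ∑ r, frameJ A B J c r * frameT A B T c m r := by
  have h1 : ∀ k i j, ∑ a, ∑ b, G i j * H a b * J a i * T b k j =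
      ∑ c, G i j * ((∑ a, B c a * J a i) * ∑ b, B c b * T b k j) := fun k i j => by
    rw [← Finset.mul_sum, ← sum_gram_contract hH]
    simp only [Finset.mul_sum, mul_assoc]
  have h2 : ∀ k, ∑ i, ∑ j, ∑ a, ∑ b, G i j * H a b * J a i * T b k j =
      ∑ c, ∑ r, frameJ A B J c r * ∑ j, A r j * ∑ b, B c b * T b k j := fun k => by
    simp only [h1]
    rw [(Finset.sum_congr rfl fun i _ => Finset.sum_comm).trans Finset.sum_comm]
    simp only [sum_gram_contract hG, frameJ]
  have h3 : ∀ (f : Fin n → ℝ) (g : Fin d → Fin n → ℝ) (X : Fin n → Fin d → Fin n → ℝ),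
      ∑ k, f k * ∑ c, ∑ r, g c r * X k c r = ∑ c, ∑ r, g c r * ∑ k, f k * X k c r := by
    intro f g X
    simp only [Finset.mul_sum]
    rw [Finset.sum_comm]
    refine Finset.sum_congr rfl fun c _ => ?_
    rw [Finset.sum_comm]
    simp only [mul_left_comm]
  simp only [h2, frameT]
  exact h3 _ _ _

theorem frame_trace (hG : G = A.transpose * A) (T : Fin d → Fin n → Fin n → ℝ) (c : Fin d) :
    ∑ a, B c a * ∑ i, ∑ j, G i j * T a i j = ∑ m, frameT A B T c m m := by
  have h1 : ∑ a, B c a * ∑ i, ∑ j, G i j * T a i j =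
      ∑ i, ∑ j, G i j * ∑ a, B c a * T a i j := by
    simp only [Finset.mul_sum]
    rw [Finset.sum_comm]
    refine Finset.sum_congr rfl fun i _ => ?_
    rw [Finset.sum_comm]
    refine Finset.sum_congr rfl fun j _ => Finset.sum_congr rfl fun a _ => ?_
    ring
  rw [h1, sum_gram_contract' hG]
  rfl

theorem frame_contract (hG : G = A.transpose * A) (J : Fin d → Fin n → ℝ) (V : Fin n → ℝ)
    (c : Fin d) :
    ∑ a, B c a * ∑ i, ∑ j, G i j * V i * J a j =
      ∑ m, (∑ k, A m k * V k) * frameJ A B J c m := by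
  have h1 : ∑ a, B c a * ∑ i, ∑ j, G i j * V i * J a j =
      ∑ i, ∑ j, G i j * (V i * ∑ a, B c a * J a j) := by
    simp only [Finset.mul_sum]
    rw [Finset.sum_comm]
    refine Finset.sum_congr rfl fun i _ => ?_
    rw [Finset.sum_comm]
    refine Finset.sum_congr rfl fun j _ => Finset.sum_congr rfl fun a _ => ?_
    ring
  rw [h1, sum_gram_contract hG]
  rfl

theorem frame_sq (hG : G = A.transpose * A) (V : Fin n → ℝ) :
    ∑ i, ∑ j, G i j * V i * V j = ∑ m, (∑ k, A m k * V k) ^ 2 := by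
  simp only [mul_assoc, sum_gram_contract hG, sq]

/-- The algebraic Kato inequality for first and second derivatives `J` and `T`, in terms of the
inverse metric `G` of the domain and the metric `H` of the target. -/
theorem kato_of_posDef (hn : 2 ≤ n) {p : ℝ} (hp : 1 < p) (hG : G.PosDef) (hH : H.PosDef)
    {J : Fin d → Fin n → ℝ} {T : Fin d → Fin n → Fin n → ℝ} (hT : ∀ a i j, T a i j = T a j i)
    {V : Fin n → ℝ} (hV : ∀ k, V k = ∑ i, ∑ j, ∑ a, ∑ b, G i j * H a b * J a i * T b k j)
    {Q : ℝ} (hQ : Q = ∑ i, ∑ j, ∑ a, ∑ b, G i j * H a b * J a i * J b j) (hQ0 : 0 < Q)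
    (heq : ∀ a, Q * ∑ i, ∑ j, G i j * T a i j + (p - 2) * ∑ i, ∑ j, G i j * V i * J a j = 0) :
    kappa p n * ∑ i, ∑ j, G i j * V i * V j ≤
      Q * ∑ i, ∑ j, ∑ k, ∑ l, ∑ a, ∑ b, G i k * G j l * H a b * T a i j * T b k l := by
  obtain ⟨A, -, hA, -, -⟩ := exists_gram hG
  obtain ⟨B, -, hB, -, -⟩ := exists_gram hH
  rw [frame_sq hA, sum_frameT_sq hA hB]
  refine kato_orthonormal hn hp (J := frameJ A B J) (T := frameT A B T)
    (V := fun m => ∑ k, A m k * V k) (frameT_symm hT) (fun m => ?_) ?_ hQ0 fun c => ?_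
  · rw [← frame_sum_mul hA hB]
    simp only [← hV]
  · rw [hQ, sum_frameJ_sq hA hB]
  · rw [← frame_trace hA, ← frame_contract hA, Finset.mul_sum, Finset.mul_sum,
      ← Finset.sum_add_distrib]
    refine Finset.sum_eq_zero fun a _ => ?_
    linear_combination B c a * heq a

theorem exists_kato_eq_of_posDef (hn : 2 ≤ n) (hd : 2 ≤ d) {p : ℝ} (hp : 1 < p) (hG : G.PosDef)
    (hH : H.PosDef) :
    ∃ (J : Fin d → Fin n → ℝ) (T : Fin d → Fin n → Fin n → ℝ) (V : Fin n → ℝ) (Q : ℝ),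
      (∀ a i j, T a i j = T a j i) ∧
      (∀ k, V k = ∑ i, ∑ j, ∑ a, ∑ b, G i j * H a b * J a i * T b k j) ∧
      Q = ∑ i, ∑ j, ∑ a, ∑ b, G i j * H a b * J a i * J b j ∧ 0 < Q ∧
      (∀ a, Q * ∑ i, ∑ j, G i j * T a i j + (p - 2) * ∑ i, ∑ j, G i j * V i * J a j = 0) ∧
      0 < ∑ i, ∑ j, G i j * V i * V j ∧
      kappa p n * ∑ i, ∑ j, G i j * V i * V j =
        Q * ∑ i, ∑ j, ∑ k, ∑ l, ∑ a, ∑ b, G i k * G j l * H a b * T a i j * T b k l := by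
  obtain ⟨A, A', hA, -, hAA⟩ := exists_gram hG
  obtain ⟨B, B', hB, hBB', hBB⟩ := exists_gram hH
  obtain ⟨J, T, V, hT, hV, hJ, heq, hpos, hκ⟩ := exists_kato_orthonormal_eq hn hd hp
  have hJ' := frameJ_inv hAA hBB J
  have hT' := frameT_inv hAA hBB T
  have hV' : ∀ m, ∑ k, A m k * ∑ i, ∑ j, ∑ a, ∑ b, G i j * H a b * frameJ A' B' J a i *
      frameT A' B' T b k j = V m := fun m => by
    rw [frame_sum_mul hA hB, hJ', hT', hV]
  refine ⟨frameJ A' B' J, frameT A' B' T, _, 1, frameT_symm hT, fun k => rfl, ?_, one_pos,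
    ?_, ?_, ?_⟩
  · rw [sum_frameJ_sq hA hB, hJ', hJ]
  -- The equation is available in the frame, that is, after applying B to the target index. Applying
  -- B' recovers the components.
  · have h : ∀ c, ∑ a, B c a * (1 * ∑ i, ∑ j, G i j * frameT A' B' T a i j + (p - 2) *
        ∑ i, ∑ j, G i j * (∑ i', ∑ j, ∑ a, ∑ b, G i' j * H a b * frameJ A' B' J a i' *
          frameT A' B' T b i j) * frameJ A' B' J a j) = 0 := fun c => by
      have h1 := frame_trace (B := B) hA (frameT A' B' T) c
      have h2 := frame_contract (B := B) hA (frameJ A' B' J) (fun i => ∑ i', ∑ j, ∑ a, ∑ b,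
        G i' j * H a b * frameJ A' B' J a i' * frameT A' B' T b i j) c
      simp only [hV', hJ', hT'] at h1 h2
      simp only [one_mul, mul_add, Finset.sum_add_distrib, h1, mul_left_comm (B c _) (p - 2)]
      rw [← Finset.mul_sum, h2]
      exact heq c
    intro a
    have h3 := congrFun (congrArg (Matrix.mulVec B') (funext h)) a
    have h4 : (fun c => ∑ a, B c a * (1 * ∑ i, ∑ j, G i j * frameT A' B' T a i j + (p - 2) *
        ∑ i, ∑ j, G i j * (∑ i', ∑ j, ∑ a, ∑ b, G i' j * H a b * frameJ A' B' J a i' *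
          frameT A' B' T b i j) * frameJ A' B' J a j)) = B.mulVec _ := rfl
    rw [h4, Matrix.mulVec_mulVec, hBB', Matrix.one_mulVec] at h3
    rw [h3]
    exact congrFun (Matrix.mulVec_zero B') a
  · rw [frame_sq hA]
    simpa only [hV'] using hpos
  · rw [frame_sq hA, sum_frameT_sq hA hB, hT']
    simpa only [hV', one_mul] using hκ

end Frames

/-! ### Partial derivatives, determinants and inverses of matrix fields. -/

section Calculus

variable {n d : ℕ}

theorem pd_congr {f f' : Coord n → ℝ} {y : Coord n} (h : f =ᶠ[nhds y] f') (i : Fin n) :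
    pd f i y = pd f' i y := by
  unfold pd; rw [h.fderiv_eq]

theorem pd_add {f f' : Coord n → ℝ} {y : Coord n} (hf : DifferentiableAt ℝ f y)
    (hf' : DifferentiableAt ℝ f' y) (i : Fin n) :
    pd (fun z => f z + f' z) i y = pd f i y + pd f' i y := by
  unfold pd; rw [fderiv_fun_add hf hf']; rfl

theorem pd_mul {f f' : Coord n → ℝ} {y : Coord n} (hf : DifferentiableAt ℝ f y)
    (hf' : DifferentiableAt ℝ f' y) (i : Fin n) :
    pd (fun z => f z * f' z) i y = pd f i y * f' y + f y * pd f' i y := by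
  unfold pd; rw [fderiv_fun_mul hf hf']
  simp; ring

theorem pd_sum {ι : Type*} {s : Finset ι} {f : ι → Coord n → ℝ} {y : Coord n}
    (hf : ∀ k ∈ s, DifferentiableAt ℝ (f k) y) (i : Fin n) :
    pd (fun z => ∑ k ∈ s, f k z) i y = ∑ k ∈ s, pd (f k) i y := by
  unfold pd; rw [fderiv_fun_sum hf]; simp

theorem pd_const (c : ℝ) (i : Fin n) (y : Coord n) : pd (fun _ => c) i y = 0 := by
  simp [pd]

theorem pd_scomp {f : Coord n → ℝ} {φ : ℝ → ℝ} {φ' : ℝ} {y : Coord n}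
    (hφ : HasDerivAt φ φ' (f y)) (hf : DifferentiableAt ℝ f y) (i : Fin n) :
    pd (fun z => φ (f z)) i y = φ' * pd f i y := by
  unfold pd
  have := (hφ.comp_hasFDerivAt y hf.hasFDerivAt).fderiv
  rw [show (fun z => φ (f z)) = φ ∘ f from rfl, this]; simp

theorem contDiffAt_pd {f : Coord n → ℝ} {y : Coord n} {k m : WithTop ℕ∞} (hf : ContDiffAt ℝ k f y)
    (hm : m + 1 ≤ k) (i : Fin n) : ContDiffAt ℝ m (pd f i) y :=
  (hf.fderiv_right hm).clm_apply contDiffAt_const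

theorem contDiffAt_coord {k : WithTop ℕ∞} {v : Coord n → Coord d} {y : Coord n}
    (hv : ContDiffAt ℝ k v y) (a : Fin d) : ContDiffAt ℝ k (fun z => v z a) y :=
  contDiffAt_euclidean.1 hv a

theorem fderiv_apply_eq_jac {v : Coord n → Coord d} {y : Coord n} (hv : DifferentiableAt ℝ v y)
    (a : Fin d) (i : Fin n) :
    fderiv ℝ v y (EuclideanSpace.single i 1) a = jac v a i y := by
  have h : HasFDerivAt (fun z => v z a) ((EuclideanSpace.proj a).comp (fderiv ℝ v y)) y :=
    (EuclideanSpace.proj a : Coord d →L[ℝ] ℝ).hasFDerivAt.comp y hv.hasFDerivAt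
  unfold jac pd
  rw [h.fderiv]; rfl

theorem euclidean_eq_sum_single (w : Coord d) :
    w = ∑ c, w c • (EuclideanSpace.single c (1 : ℝ) : Coord d) := by
  ext a
  simp [Finset.sum_apply, Pi.single_apply]

theorem fderiv_eq_sum_pd (f : Coord d → ℝ) (y w : Coord d) :
    fderiv ℝ f y w = ∑ c, w c * pd f c y := by
  conv_lhs => rw [euclidean_eq_sum_single w]
  simp [pd]

theorem pd_comp {f : Coord d → ℝ} {v : Coord n → Coord d} {y : Coord n}
    (hf : DifferentiableAt ℝ f (v y)) (hv : DifferentiableAt ℝ v y) (i : Fin n) :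
    pd (fun z => f (v z)) i y = ∑ c, jac v c i y * pd f c (v y) := by
  unfold pd
  rw [show (fun z => f (v z)) = f ∘ v from rfl, fderiv_comp y hf hv]
  simp only [ContinuousLinearMap.comp_apply]
  rw [fderiv_eq_sum_pd]
  simp only [fderiv_apply_eq_jac hv, pd]

theorem pd_pd_comm {f : Coord n → ℝ} {y : Coord n} (hf : ContDiffAt ℝ 2 f y) (i j : Fin n) :
    pd (pd f i) j y = pd (pd f j) i y := by
  have h := (hf.isSymmSndFDerivAt (by simp)).eq (EuclideanSpace.single i 1) (EuclideanSpace.single j 1)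
  have h1 : DifferentiableAt ℝ (fderiv ℝ f) y :=
    (hf.fderiv_right (m := 1) (by norm_num)).differentiableAt (by norm_num)
  have h2 : ∀ i j : Fin n, pd (pd f i) j y =
      fderiv ℝ (fderiv ℝ f) y (EuclideanSpace.single j 1) (EuclideanSpace.single i 1) := by
    intro i j
    show fderiv ℝ (fun z => fderiv ℝ f z (EuclideanSpace.single i 1)) y _ = _
    rw [fderiv_clm_apply h1 (differentiableAt_const _)]
    simp
  rw [h2, h2, h]

/-! ### Determinant and inverse of a matrix field -/

theorem contDiffAt_det {m : ℕ} {k : WithTop ℕ∞} {E : Type*} [NormedAddCommGroup E] [NormedSpace ℝ E]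
    {g : E → Matrix (Fin m) (Fin m) ℝ} {y : E} (hg : ∀ i j, ContDiffAt ℝ k (fun z => g z i j) y) :
    ContDiffAt ℝ k (fun z => (g z).det) y := by
  simp only [Matrix.det_apply']
  exact ContDiffAt.sum fun σ _ => contDiffAt_const.mul (contDiffAt_prod fun i _ => hg _ _)

theorem contDiffAt_matrix_inv {m : ℕ} {k : WithTop ℕ∞} {E : Type*} [NormedAddCommGroup E]
    [NormedSpace ℝ E] {g : E → Matrix (Fin m) (Fin m) ℝ} {y : E}
    (hg : ∀ i j, ContDiffAt ℝ k (fun z => g z i j) y) (h0 : (g y).det ≠ 0) (i j : Fin m) :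
    ContDiffAt ℝ k (fun z => (g z)⁻¹ i j) y := by
  simp only [Matrix.inv_def, Matrix.smul_apply, smul_eq_mul, Ring.inverse_eq_inv',
    Matrix.adjugate_apply]
  refine ((contDiffAt_det hg).inv h0).mul (contDiffAt_det fun a b => ?_)
  simp only [Matrix.updateRow_apply]
  split_ifs
  · exact contDiffAt_const
  · exact hg a b

/-- Jacobi's formula. -/
theorem pd_det {m : ℕ} {g : Coord n → Matrix (Fin m) (Fin m) ℝ} {y : Coord n}
    (hg : ∀ i j, DifferentiableAt ℝ (fun z => g z i j) y) (h0 : (g y).det ≠ 0) (k : Fin n) :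
    pd (fun z => (g z).det) k y =
      -- The product rule replaces one column at a time by its derivative; Cramer's rule then turns
      -- each such determinant into an entry of the adjugate applied to that column.
      (g y).det * ∑ i, ∑ j, (g y)⁻¹ i j * pd (fun z => g z j i) k y := by
  have h1 : pd (fun z => (g z).det) k y = ∑ i, ((g y).updateCol i
      (fun j => pd (fun z => g z j i) k y)).det := by
    simp only [Matrix.det_apply']
    rw [Finset.sum_comm, pd_sum]
    · refine Finset.sum_congr rfl fun σ _ => ?_
      have h2 : HasFDerivAt (fun z => ∏ i, g z (σ i) i)
          (∑ i, (∏ j ∈ Finset.univ.erase i, g y (σ j) j) • fderiv ℝ (fun z => g z (σ i) i) y) y :=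
        HasFDerivAt.finsetProd fun i _ => (hg (σ i) i).hasFDerivAt
      rw [pd_mul (differentiableAt_const _) h2.differentiableAt, pd_const, zero_mul, zero_add,
        ← Finset.mul_sum]
      congr 1
      unfold pd
      rw [h2.fderiv]
      simp only [sum_apply, smul_apply, smul_eq_mul]
      refine Finset.sum_congr rfl fun i _ => ?_
      rw [← Finset.prod_erase_mul _ _ (Finset.mem_univ i)]
      congr 1
      · refine Finset.prod_congr rfl fun j hj => ?_
        rw [Matrix.updateCol_ne (Finset.ne_of_mem_erase hj)]
      · simp
    · intro σ _
      exact (differentiableAt_const _).mul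
        (HasFDerivAt.finsetProd fun i _ => (hg (σ i) i).hasFDerivAt).differentiableAt
  rw [h1, Finset.mul_sum]
  refine Finset.sum_congr rfl fun i _ => ?_
  rw [← Matrix.cramer_apply, Matrix.cramer_eq_adjugate_mulVec, Matrix.mulVec, dotProduct,
    Finset.mul_sum]
  refine Finset.sum_congr rfl fun j _ => ?_
  rw [Matrix.inv_def, Matrix.smul_apply, smul_eq_mul, Ring.inverse_eq_inv']
  field_simp

/-- The derivative of a matrix field. -/
def pdMat {m : ℕ} (g : Coord n → Matrix (Fin m) (Fin m) ℝ) (k : Fin n) (y : Coord n) :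
    Matrix (Fin m) (Fin m) ℝ :=
  Matrix.of fun i j => pd (fun z => g z i j) k y

/-- Differentiate g⁻¹ g = 1, valid near y because the determinant stays nonzero, and multiply by g⁻¹
on the right. -/
theorem pdMat_inv {m : ℕ} {g : Coord n → Matrix (Fin m) (Fin m) ℝ} {y : Coord n}
    (hg : ∀ i j, ContDiffAt ℝ 1 (fun z => g z i j) y) (h0 : (g y).det ≠ 0) (k : Fin n) :
    pdMat (fun z => (g z)⁻¹) k y = -((g y)⁻¹ * pdMat g k y * (g y)⁻¹) := by
  have hu : IsUnit (g y).det := h0.isUnit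
  have hev : ∀ᶠ z in nhds y, (g z).det ≠ 0 :=
    (contDiffAt_det hg).continuousAt.eventually_ne h0
  have h1 : (g y)⁻¹ * pdMat g k y + pdMat (fun z => (g z)⁻¹) k y * g y = 0 := by
    ext i j
    have h2 : pd (fun z => ((g z)⁻¹ * g z) i j) k y = 0 := by
      rw [pd_congr (f' := fun _ => (1 : Matrix (Fin m) (Fin m) ℝ) i j), pd_const]
      filter_upwards [hev] with z hz
      rw [Matrix.nonsing_inv_mul _ hz.isUnit]
    simp only [Matrix.mul_apply] at h2
    have hd : ∀ i j, DifferentiableAt ℝ (fun z => (g z)⁻¹ i j) y := fun i j =>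
      (contDiffAt_matrix_inv hg h0 i j).differentiableAt (by norm_num)
    have hd' : ∀ i j, DifferentiableAt ℝ (fun z => g z i j) y := fun i j =>
      (hg i j).differentiableAt (by norm_num)
    rw [pd_sum fun l _ => (hd i l).fun_mul (hd' l j)] at h2
    rw [Matrix.zero_apply, ← h2]
    simp only [pd_mul (hd _ _) (hd' _ _), Finset.sum_add_distrib, Matrix.add_apply,
      Matrix.mul_apply, pdMat, Matrix.of_apply]
    ring
  have h3 := congrArg (· * (g y)⁻¹) h1
  simp only [Matrix.add_mul, Matrix.zero_mul, Matrix.mul_assoc, Matrix.mul_nonsing_inv _ hu,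
    Matrix.mul_one] at h3
  rw [Matrix.mul_assoc]
  exact eq_neg_of_add_eq_zero_right h3

end Calculus

/-! ### Levi-Civita connection, covariant Hessian and p-tension in coordinates. -/

section Metric

variable {n d : ℕ}

/-- `g` is the coefficient matrix of a smooth Riemannian metric on the open set `U`. -/
structure IsMetricOn (g : Coord n → Matrix (Fin n) (Fin n) ℝ) (U : Set (Coord n)) : Prop where
  isOpen : IsOpen U
  contDiffAt : ∀ y ∈ U, ∀ i j, ContDiffAt ℝ ∞ (fun z => g z i j) y
  posDef : ∀ y ∈ U, (g y).PosDef

variable {g : Coord n → Matrix (Fin n) (Fin n) ℝ} {U : Set (Coord n)} {y : Coord n}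

namespace IsMetricOn

variable (hg : IsMetricOn g U) (hy : y ∈ U)
include hg hy

theorem mem_nhds : U ∈ nhds y := hg.isOpen.mem_nhds hy

theorem differentiableAt (i j : Fin n) : DifferentiableAt ℝ (fun z => g z i j) y :=
  (hg.contDiffAt y hy i j).differentiableAt (by simp)

theorem symm (i j : Fin n) : g y i j = g y j i :=
  (hg.posDef y hy).1.apply j i

theorem det_ne_zero : (g y).det ≠ 0 := (hg.posDef y hy).det_pos.ne'

theorem contDiffAt_inv (i j : Fin n) : ContDiffAt ℝ ∞ (fun z => (g z)⁻¹ i j) y :=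
  contDiffAt_matrix_inv (hg.contDiffAt y hy) (hg.det_ne_zero hy) i j

theorem posDef_inv : (g y)⁻¹.PosDef := (hg.posDef y hy).inv

theorem inv_symm (i j : Fin n) : (g y)⁻¹ i j = (g y)⁻¹ j i :=
  (hg.posDef_inv hy).1.apply j i

theorem pd_symm (i j k : Fin n) : pd (fun z => g z i j) k y = pd (fun z => g z j i) k y :=
  pd_congr (by filter_upwards [hg.mem_nhds hy] with z hz using hg.symm hz i j) k

theorem christoffel_symm (k i j : Fin n) : christoffel g y k i j = christoffel g y k j i := by
  unfold christoffel
  congr 1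
  refine Finset.sum_congr rfl fun l _ => ?_
  rw [hg.pd_symm hy i j l]
  ring

theorem sum_mul_christoffel (m i j : Fin n) :
    ∑ k, g y m k * christoffel g y k i j =
      (1 / 2) * (pd (fun z => g z j m) i y + pd (fun z => g z i m) j y
        - pd (fun z => g z i j) m y) := by
  have h : ∀ l, ∑ k, g y m k * (g y)⁻¹ k l = if m = l then 1 else 0 := fun l => by
    rw [← Matrix.mul_apply, Matrix.mul_nonsing_inv _ (hg.det_ne_zero hy).isUnit, Matrix.one_apply]
  simp only [christoffel, mul_left_comm (g y m _), ← Finset.mul_sum]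
  congr 1
  simp only [Finset.mul_sum]
  rw [Finset.sum_comm]
  simp only [← mul_assoc, ← Finset.sum_mul, h]
  simp

end IsMetricOn

/-- The connection matrix `(Γ^s_{km})_{s m}` in the direction `k`. -/
def connMat (g : Coord n → Matrix (Fin n) (Fin n) ℝ) (k : Fin n) (y : Coord n) :
    Matrix (Fin n) (Fin n) ℝ :=
  Matrix.of fun s m => christoffel g y s k m

namespace IsMetricOn

variable (hg : IsMetricOn g U) (hy : y ∈ U)
include hg hy

theorem transpose_eq : (g y).transpose = g y := by
  ext i j; exact hg.symm hy j i

theorem transpose_inv : (g y)⁻¹.transpose = (g y)⁻¹ := by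
  ext i j; exact hg.inv_symm hy j i

/-- Metric compatibility: adding the formulas for the lowered Christoffel symbols with two indices
exchanged leaves only one derivative of g. -/
theorem pdMat_eq (k : Fin n) :
    pdMat g k y = g y * connMat g k y + (connMat g k y).transpose * g y := by
  ext i j
  have h1 := hg.sum_mul_christoffel hy i k j
  have h2 := hg.sum_mul_christoffel hy j k i
  simp only [Matrix.add_apply, Matrix.mul_apply, connMat, Matrix.transpose_apply, Matrix.of_apply,
    pdMat, mul_comm (christoffel g y _ _ _)]
  have h3 : ∑ x, g y x j * christoffel g y x k i = ∑ x, g y j x * christoffel g y x k i :=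
    Finset.sum_congr rfl fun x _ => by rw [hg.symm hy]
  rw [h3, h1, h2, hg.pd_symm hy j i k, hg.pd_symm hy k i j, hg.pd_symm hy k j i]
  rw [hg.pd_symm hy j k i, hg.pd_symm hy i k j]
  ring

theorem pdMat_inv_eq (k : Fin n) :
    pdMat (fun z => (g z)⁻¹) k y =
      -(connMat g k y * (g y)⁻¹ + (g y)⁻¹ * (connMat g k y).transpose) := by
  have hu := (hg.det_ne_zero hy).isUnit
  rw [pdMat_inv (fun i j => (hg.contDiffAt y hy i j).of_le (by simp)) (hg.det_ne_zero hy),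
    hg.pdMat_eq hy, Matrix.mul_add, Matrix.add_mul, ← Matrix.mul_assoc,
    Matrix.nonsing_inv_mul _ hu, Matrix.one_mul, Matrix.mul_assoc, Matrix.mul_assoc,
    Matrix.mul_nonsing_inv _ hu, Matrix.mul_one]

theorem volDensity_pos : 0 < volDensity g y := Real.sqrt_pos.2 (hg.posDef y hy).det_pos

theorem contDiffAt_volDensity : ContDiffAt ℝ ∞ (volDensity g) y :=
  (contDiffAt_det (hg.contDiffAt y hy)).sqrt (hg.det_ne_zero hy)

/-- Jacobi's formula for det g; by metric compatibility the trace of g⁻¹ ∂_k g is twice the trace of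
the connection matrix. -/
theorem pd_volDensity (k : Fin n) :
    pd (volDensity g) k y = volDensity g y * ∑ l, christoffel g y l k l := by
  have h0 := hg.det_ne_zero hy
  have h1 := pd_scomp (y := y) (f := fun z => (g z).det) (Real.hasDerivAt_sqrt h0)
    ((contDiffAt_det (hg.contDiffAt y hy)).differentiableAt (by simp)) k
  have h2 : ∑ i, ∑ j, (g y)⁻¹ i j * pd (fun z => g z j i) k y =
      ((g y)⁻¹ * pdMat g k y).trace := by
    simp [Matrix.trace, Matrix.mul_apply, pdMat]
  have hu := h0.isUnit
  have h3 : ((g y)⁻¹ * pdMat g k y).trace = 2 * ∑ l, christoffel g y l k l := by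
    rw [hg.pdMat_eq hy, Matrix.mul_add, ← Matrix.mul_assoc, Matrix.nonsing_inv_mul _ hu,
      Matrix.one_mul, Matrix.trace_add, Matrix.trace_mul_comm, Matrix.mul_assoc,
      Matrix.mul_nonsing_inv _ hu, Matrix.mul_one, Matrix.trace_transpose]
    simp [Matrix.trace, connMat, two_mul]
  have h4 : Real.sqrt (g y).det * Real.sqrt (g y).det = (g y).det :=
    Real.mul_self_sqrt (hg.posDef y hy).det_pos.le
  have h5 := hg.volDensity_pos hy
  unfold volDensity at h5 ⊢
  rw [h1, pd_det (hg.differentiableAt hy) h0, h2, h3]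
  field_simp
  linear_combination (-(∑ l, christoffel g y l k l)) * h4

end IsMetricOn

/-- Turns fourfold index sums into traces, so that the cancellations in `pd_gradSq` become matrix
algebra. -/
theorem sum_eq_trace (G : Matrix (Fin n) (Fin n) ℝ) (H : Matrix (Fin d) (Fin d) ℝ)
    (X Y : Matrix (Fin d) (Fin n) ℝ) :
    ∑ i, ∑ j, ∑ a, ∑ b, G i j * H a b * X a i * Y b j =
      (G * (Y.transpose * (H.transpose * X))).trace := by
  simp only [Matrix.trace, Matrix.diag_apply, Matrix.mul_apply, Matrix.transpose_apply,
    Finset.mul_sum]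
  refine Finset.sum_congr rfl fun i _ => Finset.sum_congr rfl fun j _ => ?_
  rw [Finset.sum_comm]
  refine Finset.sum_congr rfl fun b _ => Finset.sum_congr rfl fun a _ => ?_
  ring

variable {h : Coord d → Matrix (Fin d) (Fin d) ℝ} {W : Set (Coord d)} {v : Coord n → Coord d}

/-- `∂_k |∇v|² / 2`, in terms of the second covariant derivative. -/
def gradHess (g : Coord n → Matrix (Fin n) (Fin n) ℝ) (h : Coord d → Matrix (Fin d) (Fin d) ℝ)
    (v : Coord n → Coord d) (y : Coord n) (k : Fin n) : ℝ :=
  ∑ i, ∑ j, ∑ a, ∑ b, (g y)⁻¹ i j * h (v y) a b * jac v a i y * hess g h v y b k j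

/-- Second partials commute for C² maps, and both connections are torsion free. -/
theorem hess_symm (hg : IsMetricOn g U) (hy : y ∈ U) (hh : IsMetricOn h W) (hvy : v y ∈ W)
    (hv : ContDiffAt ℝ 2 v y) (a : Fin d) (i j : Fin n) :
    hess g h v y a i j = hess g h v y a j i := by
  unfold hess
  have h1 : pd (fun z => jac v a j z) i y = pd (fun z => jac v a i z) j y :=
    pd_pd_comm (contDiffAt_coord hv a) j i
  have h2 : ∑ b, ∑ c, christoffel h (v y) a b c * jac v b i y * jac v c j y =
      ∑ b, ∑ c, christoffel h (v y) a b c * jac v b j y * jac v c i y := by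
    rw [Finset.sum_comm]
    refine Finset.sum_congr rfl fun b _ => Finset.sum_congr rfl fun c _ => ?_
    rw [hh.christoffel_symm hvy]; ring
  rw [h1, h2]
  simp only [hg.christoffel_symm hy _ i j]

theorem contDiffAt_jac {m : WithTop ℕ∞} (hv : ContDiffAt ℝ (m + 1) v y) (a : Fin d) (i : Fin n) :
    ContDiffAt ℝ m (jac v a i) y :=
  contDiffAt_pd (contDiffAt_coord hv a) le_rfl i

theorem contDiffAt_gradSq {m : WithTop ℕ∞} (hm : m + 1 ≤ ∞) (hg : IsMetricOn g U) (hy : y ∈ U)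
    (hh : IsMetricOn h W) (hvy : v y ∈ W) (hv : ContDiffAt ℝ (m + 1) v y) :
    ContDiffAt ℝ m (gradSq g h v) y := by
  unfold gradSq
  have hm' : m ≤ ∞ := le_self_add.trans hm
  refine ContDiffAt.sum fun i _ => ContDiffAt.sum fun j _ => ContDiffAt.sum fun a _ =>
    ContDiffAt.sum fun b _ => ?_
  refine ((((hg.contDiffAt_inv hy i j).of_le hm').mul ?_).mul (contDiffAt_jac hv a i)).mul
    (contDiffAt_jac hv b j)
  exact ((hh.contDiffAt _ hvy a b).of_le hm').comp y (hv.of_le le_self_add)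

/-- Since both connections are metric, differentiating |∇v|² amounts to differentiating ∇v
covariantly. The derivatives of g⁻¹ and of h ∘ v supply exactly the Christoffel terms of the
Hessian. -/
theorem pd_gradSq (hg : IsMetricOn g U) (hy : y ∈ U) (hh : IsMetricOn h W) (hvy : v y ∈ W)
    (hv : ContDiffAt ℝ 2 v y) (k : Fin n) :
    pd (gradSq g h v) k y = 2 * gradHess g h v y k := by
  have hG : ∀ i j, DifferentiableAt ℝ (fun z => (g z)⁻¹ i j) y := fun i j =>
    (hg.contDiffAt_inv hy i j).differentiableAt (by simp)
  have hv1 : DifferentiableAt ℝ v y := hv.differentiableAt (by norm_num)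
  have hH : ∀ a b, DifferentiableAt ℝ (fun z => h (v z) a b) y := fun a b =>
    (hh.differentiableAt hvy a b).comp y hv1
  have hJ : ∀ a i, DifferentiableAt ℝ (fun z => jac v a i z) y := fun a i =>
    (contDiffAt_jac (m := 1) (by norm_num; exact hv) a i).differentiableAt (by norm_num)
  set G := (g y)⁻¹ with hGdef
  set H := h (v y) with hHdef
  set J : Matrix (Fin d) (Fin n) ℝ := Matrix.of fun a i => jac v a i y with hJdef
  set K : Matrix (Fin d) (Fin n) ℝ := Matrix.of fun a i => pd (fun z => jac v a i z) k y with hKdef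
  set Γ := connMat g k y with hΓ
  set C : Matrix (Fin d) (Fin d) ℝ := ∑ c, jac v c k y • connMat h c (v y) with hC
  -- C is the target connection pulled back by v in the direction k.
  have hT : (Matrix.of fun b j => hess g h v y b k j) = K - J * Γ + C * J := by
    ext b j
    simp only [hess, Matrix.add_apply, Matrix.sub_apply, Matrix.mul_apply, hC, Matrix.sum_apply,
      Matrix.smul_apply, smul_eq_mul, hJdef, hKdef, hΓ, connMat, Matrix.of_apply, Finset.sum_mul]
    congr 1
    · congr 1
      exact Finset.sum_congr rfl fun l _ => mul_comm _ _
    · rw [Finset.sum_comm]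
      refine Finset.sum_congr rfl fun c _ => Finset.sum_congr rfl fun l _ => ?_
      ring
  have hDH : pdMat (fun z => h (v z)) k y = H * C + C.transpose * H := by
    have h1 : pdMat (fun z => h (v z)) k y = ∑ c, jac v c k y • pdMat h c (v y) := by
      ext a b
      simp only [pdMat, Matrix.of_apply, Matrix.sum_apply, Matrix.smul_apply, smul_eq_mul]
      exact pd_comp (f := fun w => h w a b) (hh.differentiableAt hvy a b) hv1 k
    rw [h1, hC]
    simp only [hh.pdMat_eq hvy, smul_add, Finset.sum_add_distrib, Matrix.transpose_sum,
      Matrix.transpose_smul, Matrix.mul_sum, Matrix.sum_mul, Matrix.mul_smul, Matrix.smul_mul,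
      hHdef]
  have hDG := hg.pdMat_inv_eq hy k
  rw [← hΓ, ← hGdef] at hDG
  have hGt : G.transpose = G := hg.transpose_inv hy
  have hHt : H.transpose = H := hh.transpose_eq hvy
  have hexp : pd (gradSq g h v) k y =
      (∑ i, ∑ j, ∑ a, ∑ b, pdMat (fun z => (g z)⁻¹) k y i j * H a b * J a i * J b j) +
      (∑ i, ∑ j, ∑ a, ∑ b, G i j * pdMat (fun z => h (v z)) k y a b * J a i * J b j) +
      (∑ i, ∑ j, ∑ a, ∑ b, G i j * H a b * K a i * J b j) +
      (∑ i, ∑ j, ∑ a, ∑ b, G i j * H a b * J a i * K b j) := by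
    simp only [← Finset.sum_add_distrib]
    unfold gradSq
    have d1 : ∀ i j a b, DifferentiableAt ℝ (fun z => (g z)⁻¹ i j * h (v z) a b) y :=
      fun i j a b => (hG i j).fun_mul (hH a b)
    have d2 : ∀ i j a b, DifferentiableAt ℝ
        (fun z => (g z)⁻¹ i j * h (v z) a b * jac v a i z) y :=
      fun i j a b => (d1 i j a b).fun_mul (hJ a i)
    have d3 : ∀ i j a b, DifferentiableAt ℝ
        (fun z => (g z)⁻¹ i j * h (v z) a b * jac v a i z * jac v b j z) y :=
      fun i j a b => (d2 i j a b).fun_mul (hJ b j)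
    rw [pd_sum fun i _ => DifferentiableAt.fun_sum fun j _ => DifferentiableAt.fun_sum fun a _ =>
      DifferentiableAt.fun_sum fun b _ => d3 i j a b]
    refine Finset.sum_congr rfl fun i _ => ?_
    rw [pd_sum fun j _ => DifferentiableAt.fun_sum fun a _ =>
      DifferentiableAt.fun_sum fun b _ => d3 i j a b]
    refine Finset.sum_congr rfl fun j _ => ?_
    rw [pd_sum fun a _ => DifferentiableAt.fun_sum fun b _ => d3 i j a b]
    refine Finset.sum_congr rfl fun a _ => ?_
    rw [pd_sum fun b _ => d3 i j a b]
    refine Finset.sum_congr rfl fun b _ => ?_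
    rw [pd_mul (d2 i j a b) (hJ b j), pd_mul (d1 i j a b) (hJ a i), pd_mul (hG i j) (hH a b)]
    simp only [pdMat, Matrix.of_apply, hJdef, hKdef, hGdef, hHdef]
    ring
  have hV : gradHess g h v y k =
      ∑ i, ∑ j, ∑ a, ∑ b, G i j * H a b * J a i * (K - J * Γ + C * J) b j := by
    rw [← hT]; rfl
  rw [hexp, hV]
  simp only [sum_eq_trace, hDG, hDH, hHt]
  -- Each remaining pair of terms agrees by transposition, as G and H are symmetric and the trace is
  -- cyclic.
  have t1 : (G * (J.transpose * (H * K))).trace = (G * (K.transpose * (H * J))).trace := by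
    rw [← Matrix.trace_transpose]
    simp only [Matrix.transpose_mul, Matrix.transpose_transpose, hGt, hHt, Matrix.mul_assoc]
    rw [← Matrix.trace_mul_comm (K.transpose * (H * J)) G]
    simp only [Matrix.mul_assoc]
  have t2 : (Γ * (G * (J.transpose * (H * J)))).trace =
      (G * (Γ.transpose * (J.transpose * (H * J)))).trace := by
    rw [← Matrix.trace_transpose]
    simp only [Matrix.transpose_mul, Matrix.transpose_transpose, hGt, hHt, Matrix.mul_assoc]
    rw [← Matrix.mul_assoc G, ← Matrix.trace_mul_comm (J.transpose * (H * J))]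
    simp only [Matrix.mul_assoc]
  have t3 : (G * (J.transpose * (H * (C * J)))).trace =
      (G * (J.transpose * (C.transpose * (H * J)))).trace := by
    rw [← Matrix.trace_transpose]
    simp only [Matrix.transpose_mul, Matrix.transpose_transpose, hGt, hHt, Matrix.mul_assoc]
    rw [← Matrix.trace_mul_comm (J.transpose * (C.transpose * (H * J))) G]
    simp only [Matrix.mul_assoc]
  simp only [Matrix.transpose_add, Matrix.transpose_sub, Matrix.transpose_mul,
    Matrix.transpose_transpose, hHt, Matrix.add_mul, Matrix.sub_mul, Matrix.mul_add,
    Matrix.mul_sub, Matrix.neg_mul, Matrix.trace_add, Matrix.trace_sub, Matrix.trace_neg,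
    Matrix.mul_assoc, t1, t2, t3]
  ring

theorem gradNorm_mul_pd_gradNorm (hg : IsMetricOn g U) (hy : y ∈ U) (hh : IsMetricOn h W)
    (hvy : v y ∈ W) (hv : ContDiffAt ℝ 2 v y) (hQ : 0 < gradSq g h v y) (k : Fin n) :
    gradNorm g h v y * pd (gradNorm g h v) k y = gradHess g h v y k := by
  have hQd : DifferentiableAt ℝ (gradSq g h v) y :=
    (contDiffAt_gradSq (m := 1) (by norm_cast) hg hy hh hvy
      (by norm_num; exact hv)).differentiableAt (by norm_num)
  have hN0 : 0 < gradNorm g h v y := Real.sqrt_pos.2 hQ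
  have h1 := pd_scomp (y := y) (f := gradSq g h v) (Real.hasDerivAt_sqrt hQ.ne') hQd k
  rw [pd_gradSq hg hy hh hvy hv] at h1
  have h2 : pd (gradNorm g h v) k y = pd (fun z => Real.sqrt (gradSq g h v z)) k y := rfl
  rw [h2, h1]
  have h3 : Real.sqrt (gradSq g h v y) = gradNorm g h v y := rfl
  rw [h3]
  field_simp

/-- The components of the covariant divergence, in terms of the second covariant derivative. -/
theorem pTension_eq {p : ℝ} (hg : IsMetricOn g U) (hy : y ∈ U) (hh : IsMetricOn h W)
    (hvy : v y ∈ W) (hv : ContDiffAt ℝ 2 v y) (hQ : 0 < gradSq g h v y) (a : Fin d) :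
    gradSq g h v y * pTension p g h v y a = gradNorm g h v y ^ (p - 2) *
      (gradSq g h v y * ∑ i, ∑ j, (g y)⁻¹ i j * hess g h v y a i j +
        (p - 2) * ∑ i, ∑ j, (g y)⁻¹ i j * gradHess g h v y i * jac v a j y) := by
  have hG : ∀ i j, DifferentiableAt ℝ (fun z => (g z)⁻¹ i j) y := fun i j =>
    (hg.contDiffAt_inv hy i j).differentiableAt (by simp)
  have hJ : ∀ a i, DifferentiableAt ℝ (fun z => jac v a i z) y := fun a i =>
    (contDiffAt_jac (m := 1) (by norm_num; exact hv) a i).differentiableAt (by norm_num)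
  have hQd : DifferentiableAt ℝ (gradSq g h v) y :=
    (contDiffAt_gradSq (m := 1) (by norm_cast) hg hy hh hvy
      (by norm_num; exact hv)).differentiableAt (by norm_num)
  have hN0 : 0 < gradNorm g h v y := Real.sqrt_pos.2 hQ
  have hNsq : gradNorm g h v y * gradNorm g h v y = gradSq g h v y := Real.mul_self_sqrt hQ.le
  have hNd : DifferentiableAt ℝ (gradNorm g h v) y := hQd.sqrt hQ.ne'
  have hvol : DifferentiableAt ℝ (volDensity g) y :=
    (hg.contDiffAt_volDensity hy).differentiableAt (by simp)
  have hvol0 := hg.volDensity_pos hy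
  have hρd : DifferentiableAt ℝ (fun z => gradNorm g h v z ^ (p - 2)) y :=
    hNd.rpow_const (Or.inl hN0.ne')
  have hNpd : ∀ k, gradNorm g h v y * pd (gradNorm g h v) k y = gradHess g h v y k :=
    gradNorm_mul_pd_gradNorm hg hy hh hvy hv hQ
  -- The factor Q = |∇v|² clears the negative powers of |∇v| from the derivative of |∇v|^{p-2}.
  have hρ : ∀ k, gradSq g h v y * pd (fun z => gradNorm g h v z ^ (p - 2)) k y =
      (p - 2) * gradNorm g h v y ^ (p - 2) * gradHess g h v y k := fun k => by
    rw [pd_scomp (y := y) (f := gradNorm g h v) (φ := fun x => x ^ (p - 2))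
      (Real.hasDerivAt_rpow_const (Or.inl hN0.ne')) hNd k, ← hNpd, ← hNsq]
    have h3 : gradNorm g h v y ^ (p - 2) = gradNorm g h v y ^ (p - 2 - 1) * gradNorm g h v y := by
      rw [← Real.rpow_add_one hN0.ne']; congr 1; ring
    rw [h3]; ring
  set N := gradNorm g h v y
  set ρ := N ^ (p - 2) with hρdef
  set Q := gradSq g h v y
  have hexp : ∀ i, pd (fun z => volDensity g z * gradNorm g h v z ^ (p - 2) *
        ∑ j, (g z)⁻¹ i j * jac v a j z) i y =
      volDensity g y * (ρ * (∑ l, christoffel g y l i l) * ∑ j, (g y)⁻¹ i j * jac v a j y +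
        pd (fun z => gradNorm g h v z ^ (p - 2)) i y * ∑ j, (g y)⁻¹ i j * jac v a j y +
        ρ * ∑ j, pdMat (fun z => (g z)⁻¹) i y i j * jac v a j y +
        ρ * ∑ j, (g y)⁻¹ i j * pd (fun z => jac v a j z) i y) := fun i => by
    have d1 : ∀ j, DifferentiableAt ℝ (fun z => (g z)⁻¹ i j * jac v a j z) y := fun j =>
      (hG i j).fun_mul (hJ a j)
    rw [pd_mul (hvol.fun_mul hρd) (DifferentiableAt.fun_sum fun j _ => d1 j), pd_mul hvol hρd,
      pd_sum fun j _ => d1 j]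
    simp only [pd_mul (hG i _) (hJ a _), Finset.sum_add_distrib, hg.pd_volDensity hy]
    simp only [pdMat, Matrix.of_apply]
    ring
  -- The derivatives of √(det g) and of g⁻¹ combine to -g^{ij} Γ^k_{ij}, the domain connection term
  -- in the trace of the Hessian.
  have hcancel : ∑ i, (∑ l, christoffel g y l i l) * (∑ j, (g y)⁻¹ i j * jac v a j y) +
      ∑ i, ∑ j, pdMat (fun z => (g z)⁻¹) i y i j * jac v a j y =
      -∑ i, ∑ j, (g y)⁻¹ i j * ∑ k, christoffel g y k i j * jac v a k y := by
    have e1 : ∀ i j, pdMat (fun z => (g z)⁻¹) i y i j =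
        -(∑ l, christoffel g y i i l * (g y)⁻¹ l j) -
          ∑ l, (g y)⁻¹ i l * christoffel g y j i l := fun i j => by
      rw [hg.pdMat_inv_eq hy]
      simp [Matrix.mul_apply, connMat]
      ring
    have e2 : ∑ i, ∑ j, (∑ l, christoffel g y i i l * (g y)⁻¹ l j) * jac v a j y =
        ∑ i, (∑ l, christoffel g y l i l) * (∑ j, (g y)⁻¹ i j * jac v a j y) := by
      simp only [Finset.sum_mul_sum]
      simp only [Finset.sum_mul]
      refine ((Finset.sum_congr rfl fun i _ => Finset.sum_comm).trans Finset.sum_comm).trans ?_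
      refine Finset.sum_congr rfl fun i _ => Finset.sum_congr rfl fun l _ =>
        Finset.sum_congr rfl fun j _ => ?_
      rw [hg.christoffel_symm hy l l i]
      ring
    have e3 : ∑ i, ∑ j, (∑ l, (g y)⁻¹ i l * christoffel g y j i l) * jac v a j y =
        ∑ i, ∑ j, (g y)⁻¹ i j * ∑ k, christoffel g y k i j * jac v a k y := by
      simp only [Finset.sum_mul, Finset.mul_sum]
      refine Finset.sum_congr rfl fun i _ => ?_
      rw [Finset.sum_comm]
      refine Finset.sum_congr rfl fun j _ => Finset.sum_congr rfl fun l _ => ?_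
      ring
    simp only [e1, sub_mul, neg_mul, Finset.sum_sub_distrib, Finset.sum_neg_distrib, e2, e3]
    ring
  have hhess : ∑ i, ∑ j, (g y)⁻¹ i j * hess g h v y a i j =
      ∑ i, ∑ j, (g y)⁻¹ i j * pd (fun z => jac v a j z) i y -
      ∑ i, ∑ j, (g y)⁻¹ i j * ∑ k, christoffel g y k i j * jac v a k y +
      ∑ i, ∑ j, ∑ b, ∑ c, (g y)⁻¹ i j * christoffel h (v y) a b c * jac v b i y * jac v c j y := by
    simp only [hess, mul_add, mul_sub, Finset.sum_add_distrib, Finset.sum_sub_distrib]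
    congr 1
    simp only [Finset.mul_sum, mul_assoc]
  have hV : Q * ∑ i, pd (fun z => gradNorm g h v z ^ (p - 2)) i y *
      ∑ j, (g y)⁻¹ i j * jac v a j y =
      ρ * ((p - 2) * ∑ i, ∑ j, (g y)⁻¹ i j * gradHess g h v y i * jac v a j y) := by
    simp only [Finset.mul_sum]
    refine Finset.sum_congr rfl fun i _ => Finset.sum_congr rfl fun j _ => ?_
    linear_combination ((g y)⁻¹ i j * jac v a j y) * hρ i
  unfold pTension
  simp only [hexp]
  rw [← Finset.mul_sum, ← mul_assoc, inv_mul_cancel₀ hvol0.ne', one_mul, hhess]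
  simp only [Finset.sum_add_distrib, mul_assoc ρ, ← Finset.mul_sum]
  rw [mul_add ρ, ← hV]
  linear_combination Q * ρ * hcancel

theorem gradGradNormSq_eq (hg : IsMetricOn g U) (hy : y ∈ U) (hh : IsMetricOn h W)
    (hvy : v y ∈ W) (hv : ContDiffAt ℝ 2 v y) (hQ : 0 < gradSq g h v y) :
    gradSq g h v y * gradGradNormSq g h v y =
      ∑ i, ∑ j, (g y)⁻¹ i j * gradHess g h v y i * gradHess g h v y j := by
  have hNsq : gradNorm g h v y * gradNorm g h v y = gradSq g h v y := Real.mul_self_sqrt hQ.le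
  have hNpd : ∀ k, gradNorm g h v y * pd (gradNorm g h v) k y = gradHess g h v y k :=
    gradNorm_mul_pd_gradNorm hg hy hh hvy hv hQ
  simp only [gradGradNormSq, Finset.mul_sum, ← hNpd, ← hNsq]
  refine Finset.sum_congr rfl fun i _ => Finset.sum_congr rfl fun j _ => ?_
  ring

end Metric

/-! ### Differentiation under the integral sign. -/

open MeasureTheory in
/-- Differentiation under the integral sign over a compact set. -/
theorem hasDerivAt_setIntegral_of_contDiffAt {n : ℕ} {F : ℝ → Coord n → ℝ} {K : Set (Coord n)}
    (hK : IsCompact K) (hF : ∀ y ∈ K, ContDiffAt ℝ 1 (fun q : ℝ × Coord n => F q.1 q.2) (0, y)) :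
    HasDerivAt (fun t => ∫ y in K, F t y) (∫ y in K, deriv (fun t => F t y) 0) 0 := by
  set Φ : ℝ × Coord n → ℝ := fun q => F q.1 q.2 with hΦ
  -- By compactness of K, regularity and the derivative bound hold on all of K for one common range
  -- of t.
  have hcd : ∀ᶠ t in nhds (0 : ℝ), ∀ y ∈ K, ContDiffAt ℝ 1 Φ (t, y) :=
    hK.eventually_forall_of_forall_eventually fun y hy => (hF y hy).eventually (by simp)
  have hfc : ∀ y ∈ K, ContinuousAt (fderiv ℝ Φ) (0, y) := fun y hy =>
    ((hF y hy).fderiv_right (m := 0) (by simp)).continuousAt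
  have hcont : ContinuousOn (fun y => fderiv ℝ Φ (0, y)) K := fun y hy =>
    ((hfc y hy).comp (f := fun y => ((0 : ℝ), y)) (by fun_prop)).continuousWithinAt
  obtain ⟨C, hC⟩ := hK.exists_bound_of_continuousOn hcont
  have hbd : ∀ᶠ t in nhds (0 : ℝ), ∀ y ∈ K, ‖fderiv ℝ Φ (t, y)‖ ≤ C + 1 :=
    hK.eventually_forall_of_forall_eventually fun y hy => by
      have h := (hfc y hy).norm.eventually (gt_mem_nhds (lt_of_le_of_lt (hC y hy) (lt_add_one C)))
      exact h.mono fun q hq => hq.le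
  have hderiv : ∀ t y, ContDiffAt ℝ 1 Φ (t, y) →
      HasDerivAt (fun t => F t y) (fderiv ℝ Φ (t, y) (1, 0)) t := by
    intro t y h
    have h1 : HasFDerivAt Φ (fderiv ℝ Φ (t, y)) (t, y) :=
      (h.differentiableAt (by norm_num)).hasFDerivAt
    have h2 : HasDerivAt (fun t : ℝ => (t, y)) ((1 : ℝ), (0 : Coord n)) t :=
      (hasDerivAt_id t).prodMk (hasDerivAt_const t y)
    exact h1.comp_hasDerivAt t h2
  have hKm : MeasurableSet K := hK.measurableSet
  have key := hasDerivAt_integral_of_dominated_loc_of_deriv_le (μ := volume.restrict K)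
    (F := F) (F' := fun t y => fderiv ℝ Φ (t, y) (1, 0)) (x₀ := (0 : ℝ))
    (bound := fun _ => (C + 1) * ‖((1 : ℝ), (0 : Coord n))‖) (hcd.and hbd)
    (by
      filter_upwards [hcd] with t ht
      refine ContinuousOn.aestronglyMeasurable (fun y hy => ?_) hKm
      exact ((ht y hy).continuousAt.comp (f := fun y => (t, y))
        (by fun_prop)).continuousWithinAt)
    (by
      refine ContinuousOn.integrableOn_compact hK (fun y hy => ?_)
      exact ((hF y hy).continuousAt.comp (f := fun y => ((0 : ℝ), y))
        (by fun_prop)).continuousWithinAt)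
    ((hcont.clm_apply continuousOn_const).aestronglyMeasurable hKm)
    ((ae_restrict_iff' hKm).2 (Filter.Eventually.of_forall fun y hy t ht =>
      ((fderiv ℝ Φ (t, y)).le_opNorm _).trans
        (mul_le_mul_of_nonneg_right (ht.2 y hy) (norm_nonneg _))))
    (by
      have := hK.measure_lt_top (μ := (volume : Measure (Coord n)))
      exact (integrableOn_const this.ne))
    ((ae_restrict_iff' hKm).2 (Filter.Eventually.of_forall fun y hy t ht =>
      hderiv t y (ht.1 y hy)))
  have e : ∫ y in K, deriv (fun t => F t y) 0 = ∫ y in K, fderiv ℝ Φ (0, y) (1, 0) :=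
    setIntegral_congr_fun hKm fun y hy => (hderiv 0 y (hF y hy)).deriv
  rw [e]
  exact key.2

/-! ### From critical points of the energy to the p-harmonic equation. -/

section EulerLagrange

variable {n d : ℕ} {g : Coord n → Matrix (Fin n) (Fin n) ℝ} {U : Set (Coord n)} {y : Coord n}
  {h : Coord d → Matrix (Fin d) (Fin d) ℝ} {W : Set (Coord d)} {v : Coord n → Coord d} {p : ℝ}

/-- The density `√(det g) |∇v|^{p-2} g^{ij} h_{bc}(v) ∂_j v^c`. -/
def elFlux (p : ℝ) (g : Coord n → Matrix (Fin n) (Fin n) ℝ) (h : Coord d → Matrix (Fin d) (Fin d) ℝ)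
    (v : Coord n → Coord d) (b : Fin d) (i : Fin n) (y : Coord n) : ℝ :=
  ∑ c, h (v y) b c * (volDensity g y * gradNorm g h v y ^ (p - 2) *
    ∑ j, (g y)⁻¹ i j * jac v c j y)

/-- The density `√(det g) |∇v|^{p-2} g^{ij} ∂_b h_{ac}(v) ∂_i v^a ∂_j v^c / 2`. -/
def elSource (p : ℝ) (g : Coord n → Matrix (Fin n) (Fin n) ℝ)
    (h : Coord d → Matrix (Fin d) (Fin d) ℝ) (v : Coord n → Coord d) (b : Fin d) (y : Coord n) : ℝ :=
  (1 / 2) * (volDensity g y * gradNorm g h v y ^ (p - 2)) *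
    ∑ i, ∑ j, ∑ a, ∑ c, (g y)⁻¹ i j * pd (fun w => h w a c) b (v y) * jac v a i y * jac v c j y

theorem contDiffAt_gradNorm (hg : IsMetricOn g U) (hy : y ∈ U)
    (hh : IsMetricOn h W) (hvy : v y ∈ W) (hv : ContDiffAt ℝ 2 v y) (hQ : 0 < gradSq g h v y) :
    ContDiffAt ℝ 1 (gradNorm g h v) y :=
  (contDiffAt_gradSq (m := 1) (by norm_cast) hg hy hh hvy
    (by norm_num; exact hv)).sqrt hQ.ne'

theorem contDiffAt_elWeight (hg : IsMetricOn g U) (hy : y ∈ U)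
    (hh : IsMetricOn h W) (hvy : v y ∈ W) (hv : ContDiffAt ℝ 2 v y) (hQ : 0 < gradSq g h v y) :
    ContDiffAt ℝ 1 (fun z => volDensity g z * gradNorm g h v z ^ (p - 2)) y :=
  ((hg.contDiffAt_volDensity hy).of_le (by simp)).mul
    ((contDiffAt_gradNorm hg hy hh hvy hv hQ).rpow_const_of_ne (Real.sqrt_pos.2 hQ).ne')

theorem contDiffAt_elVector (hg : IsMetricOn g U) (hy : y ∈ U)
    (hh : IsMetricOn h W) (hvy : v y ∈ W) (hv : ContDiffAt ℝ 2 v y) (hQ : 0 < gradSq g h v y)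
    (i : Fin n) (c : Fin d) :
    ContDiffAt ℝ 1 (fun z => volDensity g z * gradNorm g h v z ^ (p - 2) *
      ∑ j, (g z)⁻¹ i j * jac v c j z) y :=
  (contDiffAt_elWeight hg hy hh hvy hv hQ).mul (ContDiffAt.sum fun j _ =>
    ((hg.contDiffAt_inv hy i j).of_le (by simp)).mul
      (contDiffAt_jac (by norm_num; exact hv) c j))

theorem contDiffAt_elFlux (hg : IsMetricOn g U) (hy : y ∈ U)
    (hh : IsMetricOn h W) (hvy : v y ∈ W) (hv : ContDiffAt ℝ 2 v y) (hQ : 0 < gradSq g h v y)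
    (b : Fin d) (i : Fin n) : ContDiffAt ℝ 1 (elFlux p g h v b i) y :=
  ContDiffAt.sum fun c _ => (((hh.contDiffAt _ hvy b c).of_le (by simp)).comp y
    (hv.of_le (by norm_num))).mul (contDiffAt_elVector hg hy hh hvy hv hQ i c)

theorem contDiffAt_elSource (hg : IsMetricOn g U) (hy : y ∈ U)
    (hh : IsMetricOn h W) (hvy : v y ∈ W) (hv : ContDiffAt ℝ 2 v y) (hQ : 0 < gradSq g h v y)
    (b : Fin d) : ContDiffAt ℝ 1 (elSource p g h v b) y := by
  refine (contDiffAt_const.mul (contDiffAt_elWeight hg hy hh hvy hv hQ)).mul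
    (ContDiffAt.sum fun i _ => ContDiffAt.sum fun j _ => ContDiffAt.sum fun a _ =>
      ContDiffAt.sum fun c _ => ((((hg.contDiffAt_inv hy i j).of_le (by simp)).mul ?_).mul
        (contDiffAt_jac (by norm_num; exact hv) a i)).mul
        (contDiffAt_jac (by norm_num; exact hv) c j))
  exact (contDiffAt_pd (hh.contDiffAt _ hvy a c) (m := 1) (by norm_cast) b).comp y
    (hv.of_le (by norm_num))

/-- The Euler-Lagrange expression is the covariant divergence with its index lowered. -/
theorem sum_pd_elFlux_sub_elSource (hg : IsMetricOn g U) (hy : y ∈ U) (hh : IsMetricOn h W)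
    (hvy : v y ∈ W) (hv : ContDiffAt ℝ 2 v y) (hQ : 0 < gradSq g h v y) (b : Fin d) :
    ∑ i, pd (elFlux p g h v b i) i y - elSource p g h v b y =
      volDensity g y * ∑ c, h (v y) b c * pTension p g h v y c := by
  have hv1 : DifferentiableAt ℝ v y := hv.differentiableAt (by norm_num)
  have hvol0 := hg.volDensity_pos hy
  have e1 : ∀ i, pd (elFlux p g h v b i) i y =
      ∑ c, (∑ e, jac v e i y * pd (fun w => h w b c) e (v y)) * (volDensity g y *
        gradNorm g h v y ^ (p - 2) * ∑ j, (g y)⁻¹ i j * jac v c j y) +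
      ∑ c, h (v y) b c * pd (fun z => volDensity g z * gradNorm g h v z ^ (p - 2) *
        ∑ j, (g z)⁻¹ i j * jac v c j z) i y := fun i => by
    have d1 : ∀ c, DifferentiableAt ℝ (fun z => h (v z) b c) y := fun c =>
      (hh.differentiableAt hvy b c).comp y hv1
    have d2 : ∀ c, DifferentiableAt ℝ (fun z => volDensity g z * gradNorm g h v z ^ (p - 2) *
        ∑ j, (g z)⁻¹ i j * jac v c j z) y := fun c =>
      (contDiffAt_elVector hg hy hh hvy hv hQ i c).differentiableAt (by norm_num)
    rw [← Finset.sum_add_distrib]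
    unfold elFlux
    rw [pd_sum fun c _ => (d1 c).fun_mul (d2 c)]
    refine Finset.sum_congr rfl fun c _ => ?_
    rw [pd_mul (d1 c) (d2 c), pd_comp (f := fun w => h w b c) (hh.differentiableAt hvy b c) hv1]
  set ρ := volDensity g y * gradNorm g h v y ^ (p - 2) with hρ
  have e2 : volDensity g y * ∑ c, h (v y) b c * pTension p g h v y c =
      ∑ i, ∑ c, h (v y) b c * pd (fun z => volDensity g z * gradNorm g h v z ^ (p - 2) *
        ∑ j, (g z)⁻¹ i j * jac v c j z) i y +
      ρ * ∑ i, ∑ j, ∑ a, ∑ e, (g y)⁻¹ i j * (∑ c, h (v y) b c * christoffel h (v y) c a e) *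
        jac v a i y * jac v e j y := by
    have e3 : ∑ i, ∑ j, ∑ a, ∑ e, (g y)⁻¹ i j * (∑ c, h (v y) b c * christoffel h (v y) c a e) *
        jac v a i y * jac v e j y = ∑ c, h (v y) b c * ∑ i, ∑ j, ∑ a, ∑ e, (g y)⁻¹ i j *
          christoffel h (v y) c a e * jac v a i y * jac v e j y := by
      simp only [Finset.mul_sum, Finset.sum_mul]
      symm
      rw [Finset.sum_comm]
      refine Finset.sum_congr rfl fun i _ => ?_
      rw [Finset.sum_comm]
      refine Finset.sum_congr rfl fun j _ => ?_
      rw [Finset.sum_comm]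
      refine Finset.sum_congr rfl fun a _ => ?_
      rw [Finset.sum_comm]
      refine Finset.sum_congr rfl fun e _ => Finset.sum_congr rfl fun c _ => ?_
      ring
    rw [e3, Finset.sum_comm, Finset.mul_sum, Finset.mul_sum, ← Finset.sum_add_distrib]
    refine Finset.sum_congr rfl fun c _ => ?_
    rw [← Finset.mul_sum]
    unfold pTension
    rw [hρ]
    field_simp
  have e4 : ∑ i, ∑ c, (∑ e, jac v e i y * pd (fun w => h w b c) e (v y)) *
      (ρ * ∑ j, (g y)⁻¹ i j * jac v c j y) =
      ρ * ∑ i, ∑ j, ∑ a, ∑ e, (g y)⁻¹ i j * pd (fun w => h w b e) a (v y) *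
        jac v a i y * jac v e j y := by
    rw [Finset.mul_sum]
    refine Finset.sum_congr rfl fun i _ => ?_
    simp only [mul_left_comm _ ρ, ← Finset.mul_sum]
    congr 1
    simp only [Finset.sum_mul_sum]
    refine ((Finset.sum_congr rfl fun c _ => Finset.sum_comm).trans Finset.sum_comm).trans ?_
    refine Finset.sum_congr rfl fun j _ => ?_
    rw [Finset.sum_comm]
    refine Finset.sum_congr rfl fun a _ => Finset.sum_congr rfl fun e _ => ?_
    ring
  -- Of the three derivatives of h in Γ_{b,ae}, two coincide after contraction, by symmetry in the
  -- summed indices. They match the derivative of h(v) in the flux; the third is the source.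
  have e5 : ∑ i, ∑ j, ∑ a, ∑ e, (g y)⁻¹ i j * pd (fun w => h w b a) e (v y) *
        jac v a i y * jac v e j y = ∑ i, ∑ j, ∑ a, ∑ e, (g y)⁻¹ i j *
          pd (fun w => h w b e) a (v y) * jac v a i y * jac v e j y := by
    rw [Finset.sum_comm]
    refine Finset.sum_congr rfl fun i _ => Finset.sum_congr rfl fun j _ => ?_
    rw [Finset.sum_comm]
    refine Finset.sum_congr rfl fun a _ => Finset.sum_congr rfl fun e _ => ?_
    rw [hg.inv_symm hy]
    ring
  have e6 : ∑ i, ∑ j, ∑ a, ∑ e, (g y)⁻¹ i j * (∑ c, h (v y) b c * christoffel h (v y) c a e) *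
        jac v a i y * jac v e j y =
      (1 / 2) * ((∑ i, ∑ j, ∑ a, ∑ e, (g y)⁻¹ i j * pd (fun w => h w b e) a (v y) *
        jac v a i y * jac v e j y) + (∑ i, ∑ j, ∑ a, ∑ e, (g y)⁻¹ i j *
          pd (fun w => h w b a) e (v y) * jac v a i y * jac v e j y) -
        ∑ i, ∑ j, ∑ a, ∑ e, (g y)⁻¹ i j * pd (fun w => h w a e) b (v y) *
          jac v a i y * jac v e j y) := by
    simp only [hh.sum_mul_christoffel hvy, ← Finset.sum_add_distrib, ← Finset.sum_sub_distrib,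
      Finset.mul_sum]
    refine Finset.sum_congr rfl fun i _ => Finset.sum_congr rfl fun j _ =>
      Finset.sum_congr rfl fun a _ => Finset.sum_congr rfl fun e _ => ?_
    rw [hh.pd_symm hvy e b, hh.pd_symm hvy a b]
    ring
  rw [e2, e6, e5]
  simp only [e1, Finset.sum_add_distrib, e4]
  unfold elSource
  rw [← hρ]
  ring

theorem jac_variation {ψ : Coord n → ℝ} (hψ : DifferentiableAt ℝ ψ y)
    (hv : DifferentiableAt ℝ v y) (t : ℝ) (b a : Fin d) (i : Fin n) :
    jac (fun z => v z + t • (ψ z • (EuclideanSpace.single b 1 : Coord d))) a i y =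
      jac v a i y + t * (pd ψ i y * if a = b then 1 else 0) := by
  have hva : DifferentiableAt ℝ (fun z => v z a) y := by
    have := differentiableAt_euclidean.1 hv a
    exact this
  unfold jac
  have e : (fun z => (v z + t • (ψ z • (EuclideanSpace.single b 1 : Coord d))) a) =
      fun z => v z a + (t * if a = b then 1 else 0) * ψ z := by
    funext z
    simp
  rw [e, pd_add hva ((differentiableAt_const _).fun_mul hψ), pd_mul (differentiableAt_const _) hψ,
    pd_const]
  ring

theorem gradSq_variation {ψ : Coord n → ℝ} (hψ : DifferentiableAt ℝ ψ y)
    (hv : DifferentiableAt ℝ v y) (t : ℝ) (b : Fin d) :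
    gradSq g h (fun z => v z + t • (ψ z • (EuclideanSpace.single b 1 : Coord d))) y =
      ∑ i, ∑ j, ∑ a, ∑ c, (g y)⁻¹ i j *
        h (v y + t • (ψ y • (EuclideanSpace.single b 1 : Coord d))) a c *
        (jac v a i y + t * (pd ψ i y * if a = b then 1 else 0)) *
        (jac v c j y + t * (pd ψ j y * if c = b then 1 else 0)) := by
  simp only [gradSq, jac_variation hψ hv]

/-- Joint regularity in (t, y) is what differentiation under the integral needs. It is read off from
the explicit formula, which has to hold at all nearby points; hence v is assumed C² on all of U. -/
theorem contDiffAt_gradSq_variation (hg : IsMetricOn g U) (hy : y ∈ U) (hh : IsMetricOn h W)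
    (hvU : ∀ z ∈ U, ContDiffAt ℝ 2 v z) (hvW : v y ∈ W) {ψ : Coord n → ℝ} (hψ : ContDiff ℝ ∞ ψ)
    (b : Fin d) :
    ContDiffAt ℝ 1 (fun q : ℝ × Coord n =>
      gradSq g h (fun z => v z + q.1 • (ψ z • (EuclideanSpace.single b 1 : Coord d))) q.2)
      (0, y) := by
  have hd : ∀ z, DifferentiableAt ℝ ψ z := fun z =>
    hψ.contDiffAt.differentiableAt (by simp)
  have hev : ∀ᶠ q : ℝ × Coord n in nhds (0, y), q.2 ∈ U :=
    continuousAt_snd.eventually (hg.mem_nhds hy)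
  refine ContDiffAt.congr_of_eventuallyEq ?_ (hev.mono fun q hq =>
    gradSq_variation (g := g) (h := h) (hd q.2) ((hvU _ hq).differentiableAt (by norm_num)) q.1 b)
  have hs : ∀ {f : Coord n → ℝ}, ContDiffAt ℝ 1 f y →
      ContDiffAt ℝ 1 (fun q : ℝ × Coord n => f q.2) (0, y) := fun hf =>
    ContDiffAt.comp (g := _) ((0 : ℝ), y) hf contDiffAt_snd
  have hψ' : ContDiffAt ℝ 1 ψ y := (hψ.of_le (by simp)).contDiffAt
  have hj : ∀ (a : Fin d) (i : Fin n), ContDiffAt ℝ 1 (fun q : ℝ × Coord n =>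
      jac v a i q.2 + q.1 * (pd ψ i q.2 * if a = b then 1 else 0)) (0, y) := fun a i =>
    (hs (contDiffAt_jac (by norm_num; exact hvU y hy) a i)).add
      (contDiffAt_fst.mul ((hs (contDiffAt_pd (k := ∞) hψ.contDiffAt (by norm_cast) i)).mul
        contDiffAt_const))
  refine ContDiffAt.sum fun i _ => ContDiffAt.sum fun j _ => ContDiffAt.sum fun a _ =>
    ContDiffAt.sum fun c _ => (((hs ((hg.contDiffAt_inv hy i j).of_le (by simp))).mul ?_).mul
      (hj a i)).mul (hj c j)
  have hinner : ContDiffAt ℝ 1 (fun q : ℝ × Coord n =>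
      v q.2 + q.1 • (ψ q.2 • (EuclideanSpace.single b 1 : Coord d))) (0, y) :=
    (ContDiffAt.comp (g := v) ((0 : ℝ), y) ((hvU y hy).of_le (by norm_num)) contDiffAt_snd).add
      (contDiffAt_fst.smul ((hs hψ').smul contDiffAt_const))
  refine ContDiffAt.comp (g := fun w => h w a c) ((0 : ℝ), y) ?_ hinner
  simp only [zero_smul, add_zero]
  exact (hh.contDiffAt _ hvW a c).of_le (by simp)

/-- The two Jacobian factors contribute equally because g⁻¹ and h are symmetric; the remaining term
is the derivative of h along the variation. -/
theorem hasDerivAt_gradSq_variation (hg : IsMetricOn g U) (hy : y ∈ U) (hh : IsMetricOn h W)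
    (hv : DifferentiableAt ℝ v y) (hvW : v y ∈ W) {ψ : Coord n → ℝ} (hψ : DifferentiableAt ℝ ψ y)
    (b : Fin d) :
    HasDerivAt (fun t : ℝ =>
      gradSq g h (fun z => v z + t • (ψ z • (EuclideanSpace.single b 1 : Coord d))) y)
      (2 * ∑ i, pd ψ i y * (∑ c, h (v y) b c * ∑ j, (g y)⁻¹ i j * jac v c j y) +
        ψ y * ∑ i, ∑ j, ∑ a, ∑ c, (g y)⁻¹ i j * pd (fun w => h w a c) b (v y) *
          jac v a i y * jac v c j y) 0 := by
  simp only [gradSq_variation hψ hv]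
  have hH : ∀ a c, HasDerivAt (fun t : ℝ =>
      h (v y + t • (ψ y • (EuclideanSpace.single b 1 : Coord d))) a c)
      (ψ y * pd (fun w => h w a c) b (v y)) 0 := fun a c => by
    have h1 : HasDerivAt (fun t : ℝ => v y + t • (ψ y • (EuclideanSpace.single b 1 : Coord d)))
        (ψ y • (EuclideanSpace.single b 1 : Coord d)) 0 := by
      simpa using ((hasDerivAt_id (0 : ℝ)).smul_const
        (ψ y • (EuclideanSpace.single b 1 : Coord d))).const_add (v y)
    have h2 : HasFDerivAt (fun w => h w a c) (fderiv ℝ (fun w => h w a c) (v y))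
        (v y + (0 : ℝ) • (ψ y • (EuclideanSpace.single b 1 : Coord d))) := by
      rw [zero_smul, add_zero]
      exact (hh.differentiableAt hvW a c).hasFDerivAt
    have h3 := h2.comp_hasDerivAt (0 : ℝ) h1
    rw [map_smul, smul_eq_mul] at h3
    exact h3
  have hj : ∀ (a : Fin d) (i : Fin n), HasDerivAt (fun t : ℝ =>
      jac v a i y + t * (pd ψ i y * if a = b then 1 else 0))
      (pd ψ i y * if a = b then 1 else 0) 0 := fun a i => by
    simpa using ((hasDerivAt_id (0 : ℝ)).mul_const
      (pd ψ i y * if a = b then 1 else 0)).const_add (jac v a i y)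
  have hsum := HasDerivAt.fun_sum (u := Finset.univ) fun i _ => HasDerivAt.fun_sum
    (u := Finset.univ) fun j _ => HasDerivAt.fun_sum (u := Finset.univ) fun a _ =>
      HasDerivAt.fun_sum (u := Finset.univ) fun c _ =>
      (((hH a c).const_mul ((g y)⁻¹ i j)).mul (hj a i)).mul (hj c j)
  refine hsum.congr_deriv ?_
  simp only [zero_smul, add_zero, zero_mul]
  have e1 : ∀ i j a c, ((g y)⁻¹ i j * (ψ y * pd (fun w => h w a c) b (v y)) * jac v a i y +
      (g y)⁻¹ i j * h (v y) a c * (pd ψ i y * if a = b then 1 else 0)) * jac v c j y +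
      (g y)⁻¹ i j * h (v y) a c * jac v a i y * (pd ψ j y * if c = b then 1 else 0) =
      ψ y * ((g y)⁻¹ i j * pd (fun w => h w a c) b (v y) * jac v a i y * jac v c j y) +
      (if a = b then pd ψ i y * (h (v y) a c * ((g y)⁻¹ i j * jac v c j y)) else 0) +
      (if c = b then pd ψ j y * (h (v y) c a * ((g y)⁻¹ j i * jac v a i y)) else 0) := by
    intro i j a c
    rw [hh.symm hvW c a, hg.inv_symm hy j i]
    split_ifs <;> ring
  have e2 : ∑ i, ∑ j, ∑ a, ∑ c, (if a = b then pd ψ i y * (h (v y) a c *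
      ((g y)⁻¹ i j * jac v c j y)) else 0) =
      ∑ i, pd ψ i y * (∑ c, h (v y) b c * ∑ j, (g y)⁻¹ i j * jac v c j y) := by
    refine Finset.sum_congr rfl fun i _ => ?_
    have h1 : ∀ j, ∑ a, ∑ c, (if a = b then pd ψ i y * (h (v y) a c *
        ((g y)⁻¹ i j * jac v c j y)) else 0) =
        ∑ c, pd ψ i y * (h (v y) b c * ((g y)⁻¹ i j * jac v c j y)) := fun j => by
      rw [Finset.sum_comm]
      simp
    simp only [h1, Finset.mul_sum]
    exact Finset.sum_comm
  have e3 : ∑ i, ∑ j, ∑ a, ∑ c, (if c = b then pd ψ j y * (h (v y) c a *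
      ((g y)⁻¹ j i * jac v a i y)) else 0) =
      ∑ i, pd ψ i y * (∑ c, h (v y) b c * ∑ j, (g y)⁻¹ i j * jac v c j y) := by
    rw [← e2, Finset.sum_comm]
    exact Finset.sum_congr rfl fun i _ => Finset.sum_congr rfl fun j _ => Finset.sum_comm
  simp only [Pi.mul_apply, e1, Finset.sum_add_distrib, e2, e3, ← Finset.mul_sum, zero_smul,
    add_zero, zero_mul]
  ring

/-- The first variation of the energy density. -/
theorem hasDerivAt_energyDensity_variation (hg : IsMetricOn g U) (hy : y ∈ U)
    (hh : IsMetricOn h W) (hv : DifferentiableAt ℝ v y) (hvW : v y ∈ W)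
    (hQ : 0 < gradSq g h v y) {ψ : Coord n → ℝ} (hψ : DifferentiableAt ℝ ψ y) (b : Fin d) :
    HasDerivAt (fun t : ℝ =>
      gradNorm g h (fun z => v z + t • (ψ z • (EuclideanSpace.single b 1 : Coord d))) y ^ p *
        volDensity g y)
      (p * (∑ i, elFlux p g h v b i y * pd ψ i y + elSource p g h v b y * ψ y)) 0 := by
  have h1 := hasDerivAt_gradSq_variation hg hy hh hv hvW hψ b
  have e0 : gradSq g h (fun z => v z + (0 : ℝ) • (ψ z • (EuclideanSpace.single b 1 : Coord d))) y =
      gradSq g h v y := by simp only [zero_smul, add_zero]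
  have hN0 : 0 < gradNorm g h v y := Real.sqrt_pos.2 hQ
  have h2 := h1.sqrt (by rw [e0]; exact hQ.ne')
  have h3 := (h2.rpow_const (p := p) (Or.inl (by rw [e0]; exact hN0.ne'))).mul_const
    (volDensity g y)
  refine h3.congr_deriv ?_
  rw [e0]
  have e1 : Real.sqrt (gradSq g h v y) = gradNorm g h v y := rfl
  have e2 : gradNorm g h v y ^ (p - 1) = gradNorm g h v y ^ (p - 2) * gradNorm g h v y := by
    rw [← Real.rpow_add_one hN0.ne']; congr 1; ring
  have e3 : ∑ i, elFlux p g h v b i y * pd ψ i y = volDensity g y * gradNorm g h v y ^ (p - 2) *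
      ∑ i, pd ψ i y * (∑ c, h (v y) b c * ∑ j, (g y)⁻¹ i j * jac v c j y) := by
    rw [Finset.mul_sum]
    refine Finset.sum_congr rfl fun i _ => ?_
    have : elFlux p g h v b i y = volDensity g y * gradNorm g h v y ^ (p - 2) *
        ∑ c, h (v y) b c * ∑ j, (g y)⁻¹ i j * jac v c j y := by
      unfold elFlux
      rw [Finset.mul_sum]
      exact Finset.sum_congr rfl fun c _ => by ring
    rw [this]; ring
  rw [e1, e2, e3]
  unfold elSource
  field_simp

open MeasureTheory in
/-- The weak form of the Euler-Lagrange equation. -/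
theorem integral_elFlux_add_elSource_eq_zero (hp : p ≠ 0) (hg : IsMetricOn g U)
    (hh : IsMetricOn h W) (hv : ∀ y ∈ U, ContDiffAt ℝ 2 v y) (hvW : ∀ y ∈ U, v y ∈ W)
    (hQ : ∀ y ∈ U, 0 < gradSq g h v y)
    (hcrit : ∀ φ : Coord n → Coord d, ContDiff ℝ ∞ φ → HasCompactSupport φ → tsupport φ ⊆ U →
      HasDerivAt (fun t : ℝ => ∫ y in tsupport φ,
        gradNorm g h (fun z => v z + t • φ z) y ^ p * volDensity g y) 0 0)
    {ψ : Coord n → ℝ} (hψ : ContDiff ℝ ∞ ψ) (hψK : HasCompactSupport ψ) (hψU : tsupport ψ ⊆ U)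
    (b : Fin d) :
    ∫ y, (∑ i, elFlux p g h v b i y * pd ψ i y + elSource p g h v b y * ψ y) = 0 := by
  -- Variations in one target coordinate at a time suffice and give one scalar equation for each b.
  set φ : Coord n → Coord d := fun z => ψ z • (EuclideanSpace.single b 1 : Coord d) with hφ
  have hts : tsupport φ = tsupport ψ := by
    unfold tsupport
    congr 1
    ext z
    simp [hφ, Function.mem_support]
  have hc := hcrit φ (hψ.smul contDiff_const) (by
    unfold HasCompactSupport; rw [hts]; exact hψK) (hts ▸ hψU)
  rw [hts] at hc
  have hd : ∀ z, DifferentiableAt ℝ ψ z := fun z =>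
    hψ.contDiffAt.differentiableAt (by simp)
  have h1 := hasDerivAt_setIntegral_of_contDiffAt (K := tsupport ψ) (F := fun t y =>
    gradNorm g h (fun z => v z + t • φ z) y ^ p * volDensity g y) hψK (fun y hy => by
      have hyU := hψU hy
      have e0 : gradSq g h (fun z => v z + (0 : ℝ) • φ z) y = gradSq g h v y := by
        simp only [zero_smul, add_zero]
      have hq := hQ y hyU
      refine ContDiffAt.mul (ContDiffAt.rpow_const_of_ne (ContDiffAt.sqrt
        (contDiffAt_gradSq_variation hg hyU hh hv (hvW y hyU) hψ b) ?_) ?_)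
        (ContDiffAt.comp (g := volDensity g) ((0 : ℝ), y)
          ((hg.contDiffAt_volDensity hyU).of_le (by simp)) contDiffAt_snd)
      · exact e0 ▸ hq.ne'
      · exact (Real.sqrt_pos.2 (e0 ▸ hq)).ne')
  have h2 := h1.unique hc
  have h3 : ∫ y in tsupport ψ, deriv (fun t : ℝ =>
      gradNorm g h (fun z => v z + t • φ z) y ^ p * volDensity g y) 0 =
      ∫ y in tsupport ψ, p * (∑ i, elFlux p g h v b i y * pd ψ i y + elSource p g h v b y * ψ y) :=
    setIntegral_congr_fun (isClosed_tsupport ψ).measurableSet fun y hy =>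
      (hasDerivAt_energyDensity_variation hg (hψU hy) hh
        ((hv y (hψU hy)).differentiableAt (by norm_num)) (hvW y (hψU hy)) (hQ y (hψU hy))
        (hd y) b).deriv
  rw [h3, integral_const_mul] at h2
  have h4 := (mul_eq_zero.1 h2).resolve_left hp
  -- Off the support both ψ and its derivatives vanish, so the integral extends to the whole space.
  rw [setIntegral_eq_integral_of_forall_compl_eq_zero] at h4
  · exact h4
  · intro y hy
    have h5 : ψ y = 0 := image_eq_zero_of_notMem_tsupport hy
    have h6 : ∀ i, pd ψ i y = 0 := fun i => by
      have : y ∉ tsupport (fderiv ℝ ψ) := fun hc => hy (tsupport_fderiv_subset ℝ hc)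
      unfold pd
      rw [image_eq_zero_of_notMem_tsupport this]; rfl
    simp [h5, h6]

-- Nothing is assumed about f outside U: the product vanishes near every point off the support of ψ,
-- so it is continuous everywhere.
open MeasureTheory in
theorem integrable_mul_of_tsupport_subset (hU : IsOpen U) {f ψ : Coord n → ℝ}
    (hf : ContinuousOn f U) (hψ : Continuous ψ) (hψK : HasCompactSupport ψ)
    (hψU : tsupport ψ ⊆ U) : Integrable (fun y => f y * ψ y) := by
  refine Continuous.integrable_of_hasCompactSupport ?_ hψK.mul_left
  rw [continuous_iff_continuousAt]
  intro y
  by_cases hy : y ∈ tsupport ψ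
  · exact (hf.continuousAt (hU.mem_nhds (hψU hy))).mul hψ.continuousAt
  · have : (fun y => f y * ψ y) =ᶠ[nhds y] fun _ => 0 := by
      filter_upwards [(isClosed_tsupport ψ).isOpen_compl.mem_nhds hy] with z hz
      rw [image_eq_zero_of_notMem_tsupport hz, mul_zero]
    exact continuousAt_const.congr this.symm

open MeasureTheory in
/-- A `C²` critical point of the `p`-energy without critical points solves the `p`-harmonic
equation. -/
theorem pTension_eq_zero (hp : p ≠ 0) (hg : IsMetricOn g U)
    (hh : IsMetricOn h W) (hv : ∀ y ∈ U, ContDiffAt ℝ 2 v y) (hvW : ∀ y ∈ U, v y ∈ W)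
    (hQ : ∀ y ∈ U, 0 < gradSq g h v y)
    (hcrit : ∀ φ : Coord n → Coord d, ContDiff ℝ ∞ φ → HasCompactSupport φ → tsupport φ ⊆ U →
      HasDerivAt (fun t : ℝ => ∫ y in tsupport φ,
        gradNorm g h (fun z => v z + t • φ z) y ^ p * volDensity g y) 0 0)
    (hy : y ∈ U) (a : Fin d) : pTension p g h v y a = 0 := by
  have hflux : ∀ b i, ∀ z ∈ U, ContDiffAt ℝ 1 (elFlux p g h v b i) z := fun b i z hz =>
    contDiffAt_elFlux hg hz hh (hvW z hz) (hv z hz) (hQ z hz) b i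
  have hsrc : ∀ b, ∀ z ∈ U, ContDiffAt ℝ 1 (elSource p g h v b) z := fun b z hz =>
    contDiffAt_elSource hg hz hh (hvW z hz) (hv z hz) (hQ z hz) b
  have hfluxc : ∀ b i, ContinuousOn (elFlux p g h v b i) U := fun b i z hz =>
    (hflux b i z hz).continuousAt.continuousWithinAt
  have hpdc : ∀ b i, ContinuousOn (pd (elFlux p g h v b i) i) U := fun b i z hz =>
    (contDiffAt_pd (m := 0) (hflux b i z hz) (by simp) i).continuousAt.continuousWithinAt
  have hsrcc : ∀ b, ContinuousOn (elSource p g h v b) U := fun b z hz =>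
    (hsrc b z hz).continuousAt.continuousWithinAt
  have hEL : ∀ b, ∀ z ∈ U,
      ∑ i, pd (elFlux p g h v b i) i z - elSource p g h v b z = 0 := by
    intro b
    have hcont : ContinuousOn
        (fun z => ∑ i, pd (elFlux p g h v b i) i z - elSource p g h v b z) U :=
      (continuousOn_finsetSum _ fun i _ => hpdc b i).sub (hsrcc b)
    -- Fundamental lemma of the calculus of variations; its hypothesis is the weak equation after
    -- integration by parts.
    have hae := hg.isOpen.ae_eq_zero_of_integral_contDiff_smul_eq_zero (μ := volume)
      (f := fun z => ∑ i, pd (elFlux p g h v b i) i z - elSource p g h v b z)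
      (hcont.locallyIntegrableOn hg.isOpen.measurableSet) (fun ψ hψ hψK hψU => by
        have hd : ∀ z, DifferentiableAt ℝ ψ z := fun z =>
          hψ.contDiffAt.differentiableAt (by simp)
        have hpdψ : ∀ i, Continuous (pd ψ i) := fun i =>
          (hψ.continuous_fderiv (by simp)).clm_apply continuous_const
        have hsub : ∀ i, tsupport (pd ψ i) ⊆ tsupport ψ := fun i =>
          (closure_mono fun z hz => by
            intro h0
            apply hz
            unfold pd
            rw [h0]; rfl).trans (tsupport_fderiv_subset ℝ)
        have hpdK : ∀ i, HasCompactSupport (pd ψ i) := fun i =>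
          hψK.of_isClosed_subset (isClosed_tsupport _) (hsub i)
        have i1 : ∀ i, Integrable (fun z => elFlux p g h v b i z * pd ψ i z) := fun i =>
          integrable_mul_of_tsupport_subset hg.isOpen (hfluxc b i) (hpdψ i) (hpdK i)
            ((hsub i).trans hψU)
        have i2 : ∀ i, Integrable (fun z => pd (elFlux p g h v b i) i z * ψ z) := fun i =>
          integrable_mul_of_tsupport_subset hg.isOpen (hpdc b i) hψ.continuous hψK hψU
        have i3 : ∀ i, Integrable (fun z => elFlux p g h v b i z * ψ z) := fun i =>
          integrable_mul_of_tsupport_subset hg.isOpen (hfluxc b i) hψ.continuous hψK hψU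
        have i4 : Integrable (fun z => elSource p g h v b z * ψ z) :=
          integrable_mul_of_tsupport_subset hg.isOpen (hsrcc b) hψ.continuous hψK hψU
        have hibp : ∀ i, ∫ z, elFlux p g h v b i z * pd ψ i z =
            -∫ z, pd (elFlux p g h v b i) i z * ψ z := fun i =>
          integral_mul_fderiv_eq_neg_fderiv_mul_of_integrable (i2 i) (i1 i) (i3 i)
            (fun z hz => (hflux b i z (hψU hz)).differentiableAt (by norm_num))
            (fun z _ => hd z)
        have hw := integral_elFlux_add_elSource_eq_zero hp hg hh hv hvW hQ hcrit hψ hψK hψU b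
        rw [integral_add (integrable_finsetSum _ fun i _ => i1 i) i4,
          integral_finsetSum _ fun i _ => i1 i] at hw
        simp only [hibp] at hw
        have e : ∀ z, ψ z • (∑ i, pd (elFlux p g h v b i) i z - elSource p g h v b z) =
            ∑ i, pd (elFlux p g h v b i) i z * ψ z - elSource p g h v b z * ψ z := fun z => by
          rw [smul_eq_mul, mul_sub, Finset.mul_sum, mul_comm (elSource p g h v b z)]
          congr 1
          exact Finset.sum_congr rfl fun i _ => mul_comm _ _
        simp only [e]
        rw [integral_sub (integrable_finsetSum _ fun i _ => i2 i) i4,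
          integral_finsetSum _ fun i _ => i2 i]
        rw [Finset.sum_neg_distrib] at hw
        linarith)
    have hae' : (fun z => ∑ i, pd (elFlux p g h v b i) i z - elSource p g h v b z)
        =ᵐ[volume.restrict U] fun _ => 0 :=
      (ae_restrict_iff' hg.isOpen.measurableSet).2 hae
    exact Measure.eqOn_open_of_ae_eq hae' hg.isOpen hcont continuousOn_const
  have hlow : ∀ b, ∑ c, h (v y) b c * pTension p g h v y c = 0 := fun b => by
    have h1 := sum_pd_elFlux_sub_elSource (p := p) hg hy hh (hvW y hy) (hv y hy) (hQ y hy) b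
    rw [hEL b y hy] at h1
    exact (mul_eq_zero.1 h1.symm).resolve_left (hg.volDensity_pos hy).ne'
  -- The Euler-Lagrange equation is the tension with lowered index; invertibility of h raises it
  -- again.
  have h2 : (h (v y)).mulVec (pTension p g h v y) = 0 := funext hlow
  have h3 := Matrix.eq_zero_of_mulVec_eq_zero (hh.det_ne_zero (hvW y hy)) h2
  exact congrFun h3 a

end EulerLagrange

/-! ### The theorem in local coordinates, and jets attaining equality. -/

section Coordinates

variable {n d : ℕ} {g : Coord n → Matrix (Fin n) (Fin n) ℝ} {U : Set (Coord n)} {y : Coord n}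
  {h : Coord d → Matrix (Fin d) (Fin d) ℝ} {W : Set (Coord d)} {v : Coord n → Coord d} {p : ℝ}

theorem IsMetricOn.mono {U' : Set (Coord n)} (hg : IsMetricOn g U) (hU : IsOpen U')
    (hsub : U' ⊆ U) : IsMetricOn g U' :=
  ⟨hU, fun y hy => hg.contDiffAt y (hsub hy), fun y hy => hg.posDef y (hsub hy)⟩

/-- In orthonormal frames |∇v|² is a sum of squares. If it vanished, all frame components would, and
inverting the frames would give a zero differential. -/
theorem gradSq_pos (hg : IsMetricOn g U) (hy : y ∈ U) (hh : IsMetricOn h W) (hvy : v y ∈ W)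
    (hv : DifferentiableAt ℝ v y) (h0 : fderiv ℝ v y ≠ 0) : 0 < gradSq g h v y := by
  obtain ⟨A, A', hA, hA', -⟩ := exists_gram (hg.posDef_inv hy)
  obtain ⟨B, B', hB, hB', -⟩ := exists_gram (hh.posDef _ hvy)
  have h1 := sum_frameJ_sq hA hB (fun a i => jac v a i y)
  change gradSq g h v y = _ at h1
  rw [h1]
  by_contra hc
  have h2 : ∑ c, ∑ m, frameJ A B (fun a i => jac v a i y) c m ^ 2 = 0 :=
    le_antisymm (not_lt.1 hc) (by positivity)
  have h3 : frameJ A B (fun a i => jac v a i y) = fun _ _ => 0 := by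
    funext c m
    have h4 := (Finset.sum_eq_zero_iff_of_nonneg fun c _ => by positivity).1 h2 c
      (Finset.mem_univ c)
    have h5 := (Finset.sum_eq_zero_iff_of_nonneg fun c _ => by positivity).1 h4 m
      (Finset.mem_univ m)
    exact pow_eq_zero_iff (two_ne_zero) |>.1 h5
  have h6 := frameJ_inv hA' hB' (fun a i => jac v a i y)
  rw [h3] at h6
  apply h0
  refine ContinuousLinearMap.ext fun w => ?_
  rw [euclidean_eq_sum_single w, map_sum]
  refine Finset.sum_eq_zero fun i _ => ?_
  rw [map_smul]
  have h7 : fderiv ℝ v y (EuclideanSpace.single i 1) = 0 := by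
    ext a
    rw [fderiv_apply_eq_jac hv, ← congrFun (congrFun h6 a) i]
    simp [frameJ]
  rw [h7, smul_zero]

/-- The Kato inequality in local coordinates. -/
theorem kappa_mul_gradGradNormSq_le (hn : 2 ≤ n) (hp : 1 < p) (hg : IsMetricOn g U) (hy : y ∈ U)
    (hh : IsMetricOn h W) (hvy : v y ∈ W) (hv : ContDiffAt ℝ 2 v y) (hQ : 0 < gradSq g h v y)
    (heq : ∀ a, pTension p g h v y a = 0) :
    kappa p n * gradGradNormSq g h v y ≤ hessSq g h v y := by
  have hN0 : 0 < gradNorm g h v y := Real.sqrt_pos.2 hQ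
  have h1 := kato_of_posDef hn hp (hg.posDef_inv hy) (hh.posDef _ hvy)
    (J := fun a i => jac v a i y) (T := hess g h v y) (V := gradHess g h v y)
    (hess_symm hg hy hh hvy hv) (fun k => rfl) (Q := gradSq g h v y) rfl hQ (fun a => by
      have h2 := pTension_eq (p := p) hg hy hh hvy hv hQ a
      rw [heq a, mul_zero] at h2
      exact (mul_eq_zero.1 h2.symm).resolve_left (Real.rpow_pos_of_pos hN0 _).ne')
  rw [← gradGradNormSq_eq hg hy hh hvy hv hQ, mul_left_comm] at h1
  exact le_of_mul_le_mul_left h1 hQ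

/-- The maps with first and second derivatives `J`, `T` solve the `p`-harmonic equation and realize
equality in the Kato inequality, for suitable `J` and `T`. -/
theorem exists_jet_kato_eq (hn : 2 ≤ n) (hd : 2 ≤ d) (hp : 1 < p) (hg : IsMetricOn g U)
    (hy : y ∈ U) (hh : IsMetricOn h W) {z : Coord d} (hz : z ∈ W) :
    ∃ (J : Fin d → Fin n → ℝ) (T : Fin d → Fin n → Fin n → ℝ), (∀ a i j, T a i j = T a j i) ∧
      ∀ v : Coord n → Coord d, v y = z → ContDiffAt ℝ 2 v y → (∀ a i, jac v a i y = J a i) →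
        (∀ a i j, hess g h v y a i j = T a i j) →
        fderiv ℝ v y ≠ 0 ∧ (∀ a, pTension p g h v y a = 0) ∧ 0 < gradGradNormSq g h v y ∧
          kappa p n * gradGradNormSq g h v y = hessSq g h v y := by
  obtain ⟨J, T, V, Q, hT, hV, hQ, hQ0, heq, hpos, hκ⟩ :=
    exists_kato_eq_of_posDef hn hd hp (hg.posDef_inv hy) (hh.posDef _ hz)
  refine ⟨J, T, hT, fun v hvz hv hJ hTv => ?_⟩
  subst hvz
  have hQ' : gradSq g h v y = Q := by simp only [gradSq, hJ, hQ]
  have hV' : ∀ k, gradHess g h v y k = V k := fun k => by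
    simp only [gradHess, hJ, hTv, hV]
  rw [← hQ'] at hQ0
  have h1 := gradGradNormSq_eq hg hy hh hz hv hQ0
  simp only [hV'] at h1
  have hE : hessSq g h v y = ∑ i, ∑ j, ∑ k, ∑ l, ∑ a, ∑ b, (g y)⁻¹ i k * (g y)⁻¹ j l *
      h (v y) a b * T a i j * T b k l := by simp only [hessSq, hTv]
  refine ⟨fun h0 => ?_, fun a => ?_, ?_, ?_⟩
  · have hJ0 : ∀ a i, J a i = 0 := fun a i => by
      rw [← hJ, ← fderiv_apply_eq_jac (hv.differentiableAt (by norm_num)), h0]; rfl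
    rw [hQ', hQ] at hQ0
    simp [hJ0] at hQ0
  · have h2 := pTension_eq (p := p) hg hy hh hz hv hQ0 a
    simp only [hTv, hV', hJ] at h2
    rw [hQ', heq a, mul_zero] at h2
    exact (mul_eq_zero.1 h2).resolve_left (hQ' ▸ hQ0).ne'
  · rw [← h1] at hpos
    exact pos_of_mul_pos_right hpos hQ0.le
  · rw [← h1, ← hE, ← hQ', mul_left_comm] at hκ
    exact mul_left_cancel₀ hQ0.ne' hκ

/-- The polynomial map with value `0`, first derivatives `J` and second derivatives `S` at `y`. -/
def quadJet (y : Coord n) (J : Fin d → Fin n → ℝ) (S : Fin d → Fin n → Fin n → ℝ)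
    (z : Coord n) : Coord d :=
  WithLp.toLp 2 fun a => ∑ i, J a i * (z i - y i) +
    (1 / 2) * ∑ i, ∑ j, S a i j * ((z i - y i) * (z j - y j))

theorem contDiff_quadJet (y : Coord n) (J : Fin d → Fin n → ℝ) (S : Fin d → Fin n → Fin n → ℝ) :
    ContDiff ℝ ∞ (quadJet y J S) := by
  rw [contDiff_euclidean]
  intro a
  simp only [quadJet]
  fun_prop

theorem quadJet_self (y : Coord n) (J : Fin d → Fin n → ℝ) (S : Fin d → Fin n → Fin n → ℝ) :
    quadJet y J S y = 0 := by
  ext a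
  simp [quadJet]

theorem pd_coord_sub (y z : Coord n) (i k : Fin n) :
    pd (fun z : Coord n => z i - y i) k z = if i = k then 1 else 0 := by
  have h1 : HasFDerivAt (fun z : Coord n => z i - y i)
      (EuclideanSpace.proj i : Coord n →L[ℝ] ℝ) z :=
    (EuclideanSpace.proj i : Coord n →L[ℝ] ℝ).hasFDerivAt.sub_const _
  unfold pd
  rw [h1.fderiv]
  simp

theorem jac_quadJet (y : Coord n) (J : Fin d → Fin n → ℝ) {S : Fin d → Fin n → Fin n → ℝ}
    (hS : ∀ a i j, S a i j = S a j i) (z : Coord n) (c : Coord d) (a : Fin d) (k : Fin n) :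
    jac (fun z => c + quadJet y J S z) a k z = J a k + ∑ j, S a k j * (z j - y j) := by
  have hc : ∀ i, DifferentiableAt ℝ (fun z : Coord n => z i - y i) z := fun i => by fun_prop
  unfold jac
  have e : (fun z => (c + quadJet y J S z) a) = fun z => c a + (∑ i, J a i * (z i - y i) +
    (1 / 2) * ∑ i, ∑ j, S a i j * ((z i - y i) * (z j - y j))) := rfl
  rw [e, pd_add (by fun_prop) (by fun_prop), pd_const, pd_add (by fun_prop) (by fun_prop),
    pd_mul (by fun_prop) (by fun_prop), pd_const, pd_sum (fun i _ => by fun_prop),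
    pd_sum (fun i _ => by fun_prop)]
  have h1 : ∀ i, pd (fun z : Coord n => J a i * (z i - y i)) k z =
      if i = k then J a i else 0 := fun i => by
    rw [pd_mul (differentiableAt_const _) (hc i), pd_const, pd_coord_sub]
    simp
  have h2 : ∀ i, pd (fun z : Coord n => ∑ j, S a i j * ((z i - y i) * (z j - y j))) k z =
      (if i = k then ∑ j, S a i j * (z j - y j) else 0) + S a i k * (z i - y i) := fun i => by
    rw [pd_sum (fun i _ => by fun_prop)]
    have h3 : ∀ j, pd (fun z : Coord n => S a i j * ((z i - y i) * (z j - y j))) k z =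
        (if i = k then S a i j * (z j - y j) else 0) +
          if j = k then S a i j * (z i - y i) else 0 := fun j => by
      rw [pd_mul (differentiableAt_const _) ((hc i).fun_mul (hc j)), pd_const,
        pd_mul (hc i) (hc j), pd_coord_sub, pd_coord_sub]
      split_ifs <;> ring
    simp only [h3, Finset.sum_add_distrib, Finset.sum_ite_eq', Finset.mem_univ, if_true]
    congr 1
    split_ifs <;> simp
  simp only [h1, h2, Finset.sum_add_distrib, Finset.sum_ite_eq', Finset.mem_univ, if_true]
  have h4 : ∑ i, S a i k * (z i - y i) = ∑ j, S a k j * (z j - y j) :=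
    Finset.sum_congr rfl fun i _ => by rw [hS]
  rw [h4]; ring

theorem pd_jac_quadJet (y : Coord n) (J : Fin d → Fin n → ℝ) {S : Fin d → Fin n → Fin n → ℝ}
    (hS : ∀ a i j, S a i j = S a j i) (z : Coord n) (c : Coord d) (a : Fin d) (i k : Fin n) :
    pd (fun z => jac (fun z => c + quadJet y J S z) a k z) i z = S a i k := by
  simp only [jac_quadJet y J hS]
  rw [pd_add (by fun_prop) (by fun_prop), pd_const, pd_sum (fun i _ => by fun_prop)]
  have h1 : ∀ j, pd (fun z : Coord n => S a k j * (z j - y j)) i z =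
      if j = i then S a k j else 0 := fun j => by
    rw [pd_mul (by fun_prop) (by fun_prop), pd_const, pd_coord_sub]
    simp
  simp [h1, hS a k i]

/-- Any first derivative and any symmetric second covariant derivative are attained. -/
theorem exists_quadJet (hg : IsMetricOn g U) (hy : y ∈ U) (hh : IsMetricOn h W) {z : Coord d}
    (hz : z ∈ W) (J : Fin d → Fin n → ℝ) {T : Fin d → Fin n → Fin n → ℝ}
    (hT : ∀ a i j, T a i j = T a j i) :
    ∃ S : Fin d → Fin n → Fin n → ℝ, ∀ v : Coord n → Coord d,
      v =ᶠ[nhds y] (fun w => z + quadJet y J S w) →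
      (∀ a i, jac v a i y = J a i) ∧ ∀ a i j, hess g h v y a i j = T a i j := by
  -- Solves the definition of the covariant Hessian for the ordinary second derivatives, given first
  -- derivatives J and value z; S is symmetric because T and the Christoffel symbols are.
  let S : Fin d → Fin n → Fin n → ℝ := fun a i j => T a i j + ∑ k, christoffel g y k i j * J a k -
    ∑ b, ∑ c, christoffel h z a b c * J b i * J c j
  have hS : ∀ a i j, S a i j = S a j i := fun a i j => by
    have h2 : ∑ b, ∑ c, christoffel h z a b c * J b i * J c j =
        ∑ b, ∑ c, christoffel h z a b c * J b j * J c i := by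
      rw [Finset.sum_comm]
      refine Finset.sum_congr rfl fun b _ => Finset.sum_congr rfl fun c _ => ?_
      rw [hh.christoffel_symm hz]; ring
    simp only [S, hT a i j, h2, hg.christoffel_symm hy _ i j]
  refine ⟨S, fun v hv => ?_⟩
  have hvy : v y = z := by rw [hv.eq_of_nhds, quadJet_self, add_zero]
  have hjac : ∀ a i, jac v a i =ᶠ[nhds y] jac (fun w => z + quadJet y J S w) a i := fun a i => by
    filter_upwards [hv.eventuallyEq_nhds] with w hw
    exact pd_congr (hw.mono fun x hx => by rw [hx]) i
  have hJ : ∀ a i, jac v a i y = J a i := fun a i => by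
    rw [(hjac a i).eq_of_nhds, jac_quadJet y J hS]
    simp
  refine ⟨hJ, fun a i j => ?_⟩
  have h1 : pd (fun w => jac v a j w) i y = S a i j := by
    rw [pd_congr (hjac a j), pd_jac_quadJet y J hS]
  simp only [hess, h1, hJ, hvy, S]
  ring

end Coordinates

/-! ### Transfer to manifolds through charts. -/

section Manifold

variable {n d : ℕ}
  {M : Type*} [TopologicalSpace M] [ChartedSpace (EuclideanSpace ℝ (Fin n)) M]
  {N : Type*} [TopologicalSpace N] [ChartedSpace (EuclideanSpace ℝ (Fin d)) N]

theorem chartRep_self (u : M → N) (q : M) :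
    chartRep (n := n) (d := d) u q (u q) (extChartAt (𝓡 n) q q) = extChartAt (𝓡 d) (u q) (u q) := by
  simp only [chartRep, extChartAt_to_inv]

theorem mfderiv_eq_fderiv_chartRep {u : M → N} {q : M} (hu : MDifferentiableAt (𝓡 n) (𝓡 d) u q) :
    mfderiv (𝓡 n) (𝓡 d) u q =
      fderiv ℝ (chartRep (n := n) (d := d) u q (u q)) (extChartAt (𝓡 n) q q) := by
  rw [hu.mfderiv, ModelWithCorners.range_eq_univ, fderivWithin_univ]
  rfl

variable [IsManifold (𝓡 n) ∞ M]

/-- The coordinate field is a constant section of the model tangent bundle pushed forward by the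
tangent map of the inverse chart. -/
theorem contMDiffAt_coordVec (x₀ : M) (i : Fin n) {y : Coord n}
    (hy : y ∈ (extChartAt (𝓡 n) x₀).target) :
    ContMDiffAt 𝓘(ℝ, Coord n) (𝓡 n).tangent ∞
      (fun y => (⟨(extChartAt (𝓡 n) x₀).symm y, coordVec x₀ y i⟩ : TangentBundle (𝓡 n) M)) y := by
  have hopen : IsOpen (extChartAt (𝓡 n) x₀).target := isOpen_extChartAt_target x₀
  have h1 := (contMDiffOn_extChartAt_symm (n := ∞) (I := 𝓡 n) x₀).contMDiffOn_tangentMapWithin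
    (m := ∞) (by simp) hopen.uniqueMDiffOn
  have h2 : ContMDiffAt 𝓘(ℝ, Coord n) 𝓘(ℝ, Coord n).tangent ∞
      (fun y => (⟨y, (EuclideanSpace.single i (1 : ℝ) : Coord n)⟩ :
        TangentBundle 𝓘(ℝ, Coord n) (Coord n))) y :=
    contMDiffAt_vectorSpace_iff_contDiffAt.2 contDiffAt_const
  have h3 := (h1.contMDiffAt (x := (⟨y, (EuclideanSpace.single i (1 : ℝ) : Coord n)⟩ :
        TangentBundle 𝓘(ℝ, Coord n) (Coord n))) (by
      exact (hopen.preimage (FiberBundle.continuous_proj (Coord n) _)).mem_nhds hy)).comp y h2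
  refine h3.congr_of_eventuallyEq ?_
  filter_upwards [hopen.mem_nhds hy] with z hz
  simp only [Function.comp_apply, tangentMapWithin, coordVec]
  rw [mfderivWithin_of_isOpen hopen hz]

theorem contDiffAt_chartRep {u : M → N} {q : M} {k : WithTop ℕ∞} (hk : k ≤ ∞)
    (hu : ContMDiffAt (𝓡 n) (𝓡 d) k u q) :
    ContDiffAt ℝ k (chartRep (n := n) (d := d) u q (u q)) (extChartAt (𝓡 n) q q) := by
  rw [← contMDiffAt_iff_contDiffAt]
  have h1 : ContMDiffAt 𝓘(ℝ, Coord n) (𝓡 n) k (extChartAt (𝓡 n) q).symm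
      (extChartAt (𝓡 n) q q) :=
    ((contMDiffOn_extChartAt_symm (n := ∞) q).contMDiffAt (extChartAt_target_mem_nhds q)).of_le hk
  have h2 : ContMDiffAt (𝓡 d) 𝓘(ℝ, Coord d) k (extChartAt (𝓡 d) (u q)) (u q) :=
    (contMDiffAt_extChartAt (n := ∞)).of_le hk
  have h3 : ContMDiffAt 𝓘(ℝ, Coord n) (𝓡 d) k (u ∘ (extChartAt (𝓡 n) q).symm)
      (extChartAt (𝓡 n) q q) :=
    ContMDiffAt.comp _ (by rw [extChartAt_to_inv]; exact hu) h1
  refine ContMDiffAt.comp (g := extChartAt (𝓡 d) (u q)) _ ?_ h3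
  simp only [extChartAt_to_inv]
  exact h2

/-- Maps with a prescribed polynomial expression in charts near a point. -/
theorem exists_contMDiff_chartRep_eq [T2Space M] [IsManifold (𝓡 d) ∞ N] (q : M) (b : N) {w : Coord n → Coord d}
    (hw : ContDiff ℝ ∞ w) (hw0 : w (extChartAt (𝓡 n) q q) = 0) :
    ∃ u : M → N, ContMDiff (𝓡 n) (𝓡 d) ∞ u ∧ u q = b ∧
      chartRep (n := n) (d := d) u q b =ᶠ[nhds (extChartAt (𝓡 n) q q)]
        fun y => extChartAt (𝓡 d) b b + w y := by
  set z₀ := extChartAt (𝓡 d) b b with hz₀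
  obtain ⟨ε, hε, hball⟩ := Metric.mem_nhds_iff.1 (extChartAt_target_mem_nhds (I := 𝓡 d) b)
  have hwq : ContinuousAt (fun x => w (extChartAt (𝓡 n) q x)) q :=
    hw.continuous.continuousAt.comp (continuousAt_extChartAt q)
  have hs : {x | w (extChartAt (𝓡 n) q x) ∈ Metric.ball (0 : Coord d) ε} ∈ nhds q :=
    hwq (by
      change _ ∈ nhds (w (extChartAt (𝓡 n) q q))
      rw [hw0]; exact Metric.ball_mem_nhds _ hε)
  -- The support of the bump is so small that w stays below ε on it. The cut-off polynomial then
  -- takes values in a ball inside the target chart, and the inverse chart applies at every point of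
  -- M.
  obtain ⟨f, hf, -⟩ := (SmoothBumpFunction.nhds_basis_support (I := 𝓡 n) hs).mem_iff.1 hs
  have hfw : ContMDiff (𝓡 n) 𝓘(ℝ, Coord d) ∞ fun x => f x • w (extChartAt (𝓡 n) q x) :=
    f.contMDiff_smul (hw.contMDiff.comp_contMDiffOn contMDiffOn_extChartAt)
  have hmem : ∀ x, z₀ + f x • w (extChartAt (𝓡 n) q x) ∈ (extChartAt (𝓡 d) b).target := by
    intro x
    apply hball
    rw [Metric.mem_ball, dist_eq_norm, add_sub_cancel_left]
    by_cases hx : x ∈ tsupport f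
    · have h1 : ‖w (extChartAt (𝓡 n) q x)‖ < ε := by simpa using hf hx
      rw [norm_smul, Real.norm_of_nonneg f.nonneg]
      exact lt_of_le_of_lt (mul_le_of_le_one_left (norm_nonneg _) f.le_one) h1
    · rw [image_eq_zero_of_notMem_tsupport hx]
      simpa using hε
  have hu : ContMDiff (𝓡 n) (𝓡 d) ∞ fun x =>
      (extChartAt (𝓡 d) b).symm (z₀ + f x • w (extChartAt (𝓡 n) q x)) := by
    rw [← contMDiffOn_univ]
    exact (contMDiffOn_extChartAt_symm b).comp (contMDiff_const.add hfw).contMDiffOn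
      fun x _ => hmem x
  refine ⟨_, hu, ?_, ?_⟩
  · simp only [hw0, smul_zero, add_zero, hz₀, extChartAt_to_inv]
  · have hsymm : ContinuousAt (extChartAt (𝓡 n) q).symm (extChartAt (𝓡 n) q q) :=
      continuousAt_extChartAt_symm q
    have h1 : ∀ᶠ y in nhds (extChartAt (𝓡 n) q q), f ((extChartAt (𝓡 n) q).symm y) = 1 :=
      hsymm.eventually (by rw [extChartAt_to_inv]; exact f.eventuallyEq_one)
    filter_upwards [h1, extChartAt_target_mem_nhds (I := 𝓡 n) q] with y hy hyt
    have h2 := hmem ((extChartAt (𝓡 n) q).symm y)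
    simp only [chartRep]
    rw [(extChartAt (𝓡 d) b).right_inv h2, hy, (extChartAt (𝓡 n) q).right_inv hyt, one_smul]

variable
  [Bundle.RiemannianBundle (fun x : M => TangentSpace (𝓡 n) x)]
  [IsContMDiffRiemannianBundle (𝓡 n) ∞ (EuclideanSpace ℝ (Fin n))
      (fun x : M => TangentSpace (𝓡 n) x)]

/-- The Gram matrix of the coordinate fields is positive definite because the differential of the
inverse chart is injective. -/
theorem isMetricOn_metricCoeff (x₀ : M) :
    IsMetricOn (metricCoeff (n := n) x₀) (extChartAt (𝓡 n) x₀).target where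
  isOpen := isOpen_extChartAt_target x₀
  contDiffAt y hy i j := by
    rw [← contMDiffAt_iff_contDiffAt]
    exact ContMDiffAt.inner_bundle (contMDiffAt_coordVec x₀ i hy) (contMDiffAt_coordVec x₀ j hy)
  posDef y hy := by
    have hopen : IsOpen (extChartAt (𝓡 n) x₀).target := isOpen_extChartAt_target x₀
    have hinv := isInvertible_mfderivWithin_extChartAt_symm (I := 𝓡 n) hy
    rw [ModelWithCorners.range_eq_univ, mfderivWithin_univ] at hinv
    refine Matrix.PosDef.of_dotProduct_mulVec_pos ?_ fun c hc => ?_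
    · ext i j
      exact real_inner_comm (coordVec x₀ y i) (coordVec x₀ y j)
    · have h1 : star c ⬝ᵥ (metricCoeff (n := n) x₀ y).mulVec c =
          inner ℝ (∑ i, c i • coordVec x₀ y i) (∑ j, c j • coordVec x₀ y j) := by
        simp only [sum_inner, inner_sum, inner_smul_left, inner_smul_right, dotProduct,
          Matrix.mulVec, metricCoeff, Matrix.of_apply, Finset.mul_sum]
        refine Finset.sum_congr rfl fun i _ => Finset.sum_congr rfl fun j _ => ?_
        rw [real_inner_comm (coordVec x₀ y i) (coordVec x₀ y j)]
        simp only [star_trivial, conj_trivial]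
        ring
      rw [h1]
      refine real_inner_self_pos.2 fun h0 => hc ?_
      have h2 : ∑ i, c i • coordVec x₀ y i =
          mfderiv 𝓘(ℝ, Coord n) (𝓡 n) (extChartAt (𝓡 n) x₀).symm y (WithLp.toLp 2 c : Coord n) := by
        rw [euclidean_eq_sum_single (WithLp.toLp 2 c)]
        erw [map_sum]
        refine Finset.sum_congr rfl fun i _ => ?_
        erw [map_smul]
        rfl
      rw [h2] at h0
      have h3 := hinv.injective (h0.trans (map_zero _).symm)
      have h4 : (WithLp.toLp 2 c : Coord n) = 0 := h3
      funext i
      exact congrArg (fun w : Coord n => w i) h4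

variable [IsManifold (𝓡 d) ∞ N]
  [Bundle.RiemannianBundle (fun x : N => TangentSpace (𝓡 d) x)]
  [IsContMDiffRiemannianBundle (𝓡 d) ∞ (EuclideanSpace ℝ (Fin d))
      (fun x : N => TangentSpace (𝓡 d) x)]

theorem kappa_mul_gradGradNormSqAt_le (hn : 2 ≤ n) {p : ℝ} (hp : 1 < p) {u : M → N} {Ω : Set M}
    {q : M} (hΩ : IsOpen Ω) (hq : q ∈ Ω) (hharm : IsPHarmonicOn (n := n) (d := d) p u Ω)
    (hu : ContMDiffAt (𝓡 n) (𝓡 d) 2 u q) (h0 : mfderiv (𝓡 n) (𝓡 d) u q ≠ 0) :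
    kappa p n * gradGradNormSqAt (n := n) (d := d) u q ≤ hessSqAt (n := n) (d := d) u q := by
  set y₀ := extChartAt (𝓡 n) q q with hy₀
  set v := chartRep (n := n) (d := d) u q (u q) with hvdef
  set g := metricCoeff (n := n) q
  set h := metricCoeff (n := d) (u q)
  have hg : IsMetricOn g (extChartAt (𝓡 n) q).target := isMetricOn_metricCoeff q
  have hh : IsMetricOn h (extChartAt (𝓡 d) (u q)).target := isMetricOn_metricCoeff (u q)
  have hy₀t : y₀ ∈ (extChartAt (𝓡 n) q).target := mem_extChartAt_target q
  have hv : ContDiffAt ℝ 2 v y₀ := contDiffAt_chartRep (by norm_cast) hu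
  have hvy : v y₀ ∈ (extChartAt (𝓡 d) (u q)).target := by
    rw [hvdef, chartRep_self]; exact mem_extChartAt_target (u q)
  have hQ : 0 < gradSq g h v y₀ := by
    refine gradSq_pos hg hy₀t hh hvy (hv.differentiableAt (by norm_num)) ?_
    rw [← mfderiv_eq_fderiv_chartRep (hu.mdifferentiableAt (by norm_num))]
    exact h0
  refine kappa_mul_gradGradNormSq_le hn hp hg hy₀t hh hvy hv hQ ?_
  have hsymm : ContinuousAt (extChartAt (𝓡 n) q).symm y₀ := continuousAt_extChartAt_symm q
  have husymm : ContinuousAt (fun y => u ((extChartAt (𝓡 n) q).symm y)) y₀ :=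
    ContinuousAt.comp (g := u) (by rw [extChartAt_to_inv]; exact hu.continuousAt) hsymm
  -- All requirements of `pTension_eq_zero` are open conditions holding at q, so they hold on a
  -- common neighbourhood, to which the variations are restricted.
  have hev : ∀ᶠ y in nhds y₀, y ∈ (extChartAt (𝓡 n) q).target ∧
      (extChartAt (𝓡 n) q).symm y ∈ Ω ∧
      u ((extChartAt (𝓡 n) q).symm y) ∈ (extChartAt (𝓡 d) (u q)).source ∧
      ContDiffAt ℝ 2 v y ∧ 0 < gradSq g h v y := by
    refine Filter.Eventually.and (hg.mem_nhds hy₀t) (Filter.Eventually.and ?_ (Filter.Eventually.and ?_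
      (Filter.Eventually.and (hv.eventually (by simp)) ?_)))
    · exact hsymm.eventually (hΩ.mem_nhds (by rw [extChartAt_to_inv]; exact hq))
    · refine husymm.eventually ((isOpen_extChartAt_source (u q)).mem_nhds ?_)
      simp only [y₀, extChartAt_to_inv]
      exact mem_extChartAt_source (u q)
    · exact (contDiffAt_gradSq (m := 1) (by norm_cast) hg hy₀t hh hvy
        (by norm_num; exact hv)).continuousAt.eventually (lt_mem_nhds hQ)
  obtain ⟨U, hU, hUo, hyU⟩ := mem_nhds_iff.1 hev
  intro a
  refine pTension_eq_zero (by linarith) (hg.mono hUo fun y hy => (hU hy).1) hh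
    (fun y hy => (hU hy).2.2.2.1)
    (fun y hy => (extChartAt (𝓡 d) (u q)).map_source (hU hy).2.2.1)
    (fun y hy => (hU hy).2.2.2.2) (fun φ hφ hφK hφU => ?_) hyU a
  exact hharm.2 q (u q) φ hφ hφK fun y hy =>
    ⟨(hU (hφU hy)).1, (hU (hφU hy)).2.1, (hU (hφU hy)).2.2.1⟩

theorem exists_kappa_mul_gradGradNormSqAt_eq [T2Space M] (hn : 2 ≤ n) (hd : 2 ≤ d) {p : ℝ}
    (hp : 1 < p) (q : M) (b : N) :
    ∃ u : M → N, ContMDiff (𝓡 n) (𝓡 d) ∞ u ∧ u q = b ∧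
      mfderiv (𝓡 n) (𝓡 d) u q ≠ 0 ∧ SolvesPHarmonicAt (n := n) (d := d) p u q ∧
      0 < gradGradNormSqAt (n := n) (d := d) u q ∧
      kappa p n * gradGradNormSqAt (n := n) (d := d) u q = hessSqAt (n := n) (d := d) u q := by
  have hg := isMetricOn_metricCoeff (n := n) q
  have hh := isMetricOn_metricCoeff (n := d) b
  have hy := mem_extChartAt_target (I := 𝓡 n) q
  have hz := mem_extChartAt_target (I := 𝓡 d) b
  obtain ⟨J, T, hT, hjet⟩ := exists_jet_kato_eq hn hd hp hg hy hh hz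
  obtain ⟨S, hS⟩ := exists_quadJet hg hy hh hz J hT
  obtain ⟨u, hu, hub, huv⟩ := exists_contMDiff_chartRep_eq q b (contDiff_quadJet _ J S)
    (quadJet_self _ J S)
  subst hub
  have hv : ContDiffAt ℝ 2 (chartRep (n := n) (d := d) u q (u q)) (extChartAt (𝓡 n) q q) :=
    contDiffAt_chartRep (by norm_cast) (hu.contMDiffAt.of_le (by norm_cast))
  obtain ⟨h1, h2, h3, h4⟩ := hjet _ (chartRep_self u q) hv (hS _ huv).1 (hS _ huv).2
  refine ⟨u, hu, rfl, ?_, h2, h3, h4⟩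
  rw [mfderiv_eq_fderiv_chartRep (hu.contMDiffAt.mdifferentiableAt (by simp))]
  exact h1

end Manifold

end PHarmonic

end

theorem mainTheorem1 {n d : ℕ} (hn : 2 ≤ n) (hd : 2 ≤ d) {p : ℝ} (hp : 1 < p)
    {M : Type*} [TopologicalSpace M] [T2Space M] [SecondCountableTopology M]
    [ChartedSpace (EuclideanSpace ℝ (Fin n)) M] [IsManifold (𝓡 n) ∞ M]
    [Bundle.RiemannianBundle (fun x : M => TangentSpace (𝓡 n) x)]
    [IsContMDiffRiemannianBundle (𝓡 n) ∞ (EuclideanSpace ℝ (Fin n))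
      (fun x : M => TangentSpace (𝓡 n) x)]
    {N : Type*} [TopologicalSpace N] [T2Space N] [SecondCountableTopology N]
    [ChartedSpace (EuclideanSpace ℝ (Fin d)) N] [IsManifold (𝓡 d) ∞ N]
    [Bundle.RiemannianBundle (fun x : N => TangentSpace (𝓡 d) x)]
    [IsContMDiffRiemannianBundle (𝓡 d) ∞ (EuclideanSpace ℝ (Fin d))
      (fun x : N => TangentSpace (𝓡 d) x)] :
    (∀ (u : M → N) (Ω : Set M) (q : M), IsOpen Ω → q ∈ Ω →
      PHarmonic.IsPHarmonicOn (n := n) (d := d) p u Ω →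
      ContMDiffAt (𝓡 n) (𝓡 d) 2 u q → mfderiv (𝓡 n) (𝓡 d) u q ≠ 0 →
      PHarmonic.kappa p n * PHarmonic.gradGradNormSqAt (n := n) (d := d) u q ≤
        PHarmonic.hessSqAt (n := n) (d := d) u q) ∧
    (∀ (q : M) (b : N), ∃ u : M → N, ContMDiff (𝓡 n) (𝓡 d) ∞ u ∧ u q = b ∧
      mfderiv (𝓡 n) (𝓡 d) u q ≠ 0 ∧ PHarmonic.SolvesPHarmonicAt (n := n) (d := d) p u q ∧
      0 < PHarmonic.gradGradNormSqAt (n := n) (d := d) u q ∧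
      PHarmonic.kappa p n * PHarmonic.gradGradNormSqAt (n := n) (d := d) u q =
        PHarmonic.hessSqAt (n := n) (d := d) u q) :=
  ⟨fun _ _ _ hΩ hq hharm hu h0 =>
      PHarmonic.kappa_mul_gradGradNormSqAt_le hn hp hΩ hq hharm hu h0,
    PHarmonic.exists_kappa_mul_gradGradNormSqAt_eq hn hd hp⟩
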